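/- Let $n\ge 1$. A weight on $\mathbb R^n$ is a nonnegative measurable function that is positive almost everywhere. For weights $\omega_1,\omega_2$ put $$[\omega_1,\omega_2]_{A_{(2,2)}}=\sup_Q\Big(\frac1{|Q|}\int_Q\omega_1^{1/2}\omega_2^{1/2}\Big)\Big(\frac1{|Q|}\int_Q\omega_1^{-1}\Big)^{1/2}\Big(\frac1{|Q|}\int_Q\omega_2^{-1}\Big)^{1/2}\in[1,\infty],$$ the supremum being over all cubes $Q\subset\mathbb R^n$ with sides parallel to the axes, and write $(\omega_1,\omega_2)\in A_{(2,2)}$ if this is finite. For $r>0$ and $C\ge0$ consider the bound $$[\omega_1^{1+r},\omega_2^{1+r}]_{A_{(2,2)}}\le C\,[\omega_1,\omega_2]_{A_{(2,2)}}^{1+r}.\qquad(\ast)$$ (Necessity) For every $t_0>1$ there is a constant $K>0$, depending only on $n$ and $t_0$, such that the following holds. Let $r:[1,\infty)\to(0,\infty)$ be a function and $C\ge0$ a constant such that every pair $(\omega_1,\omega_2)\in A_{(2,2)}$ satisfies $(\ast)$ with exponent $r=r([\omega_1,\omega_2]_{A_{(2,2)}})$ and this $C$. Then $r(t)\le K\,t^{-2}$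 for all $t\ge t_0$. (Sufficiency) There are constants $c>0$ and $C\ge 0$, depending only on $n$, such that $(\ast)$ holds with this $C$ for every $(\omega_1,\omega_2)\in A_{(2,2)}$ and every $r$ with $0<r\le c\,[\omega_1,\omega_2]_{A_{(2,2)}}^{-2}$. Thus, up to the values of the constants, $(\ast)$ holds if and only if $r\lesssim[\omega_1,\omega_2]_{A_{(2,2)}}^{-2}$. -/

import Mathlib

open MeasureTheory
open scoped NNReal ENNReal

noncomputable section

namespace BilinearWeights

/-- The closed cube in `ℝⁿ` with sides parallel to the axes, lower corner `a` and side length `l`. -/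
def cube {n : ℕ} (a : Fin n → ℝ) (l : ℝ) : Set (Fin n → ℝ) :=
  Set.Icc a (fun i => a i + l)

/-- A weight on `ℝⁿ`: a nonnegative measurable function which is positive almost everywhere.
(As usual for multiple weights, the single components need not be locally integrable.) -/
structure IsWeight {n : ℕ} (w : (Fin n → ℝ) → ℝ) : Prop where
  aemeasurable : AEMeasurable w volume
  nonneg : ∀ x, 0 ≤ w x
  ae_pos : ∀ᵐ x ∂(volume : Measure (Fin n → ℝ)), 0 < w x

/-- The constant `[w₁, w₂]` of the class `A_(2,2)`, with values in `[0, ∞]`: the supremum over all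
cubes `Q` of `(⨍_Q w₁^(1/2) w₂^(1/2)) (⨍_Q w₁⁻¹)^(1/2) (⨍_Q w₂⁻¹)^(1/2)`. -/
def a22Const {n : ℕ} (w₁ w₂ : (Fin n → ℝ) → ℝ) : ℝ≥0∞ :=
  ⨆ (a : Fin n → ℝ) (l : ℝ) (_ : 0 < l),
    (⨍⁻ x in cube a l, ENNReal.ofReal (w₁ x) ^ (1 / 2 : ℝ) * ENNReal.ofReal (w₂ x) ^ (1 / 2 : ℝ)
        ∂volume) *
      (⨍⁻ x in cube a l, (ENNReal.ofReal (w₁ x))⁻¹ ∂volume) ^ (1 / 2 : ℝ) *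
      (⨍⁻ x in cube a l, (ENNReal.ofReal (w₂ x))⁻¹ ∂volume) ^ (1 / 2 : ℝ)

/-- The pair of weights `(w₁, w₂)` belongs to the class `A_(2,2)`. -/
structure IsA22 {n : ℕ} (w₁ w₂ : (Fin n → ℝ) → ℝ) : Prop where
  left : IsWeight w₁
  right : IsWeight w₂
  const_lt_top : a22Const w₁ w₂ < ∞

/-- The reverse Hölder bound `[w₁^(1+r), w₂^(1+r)] ≤ C [w₁, w₂]^(1+r)` for one pair, with exponent
`r` and constant `C`. -/
def RevHolder {n : ℕ} (C : ℝ≥0) (w₁ w₂ : (Fin n → ℝ) → ℝ) (r : ℝ) : Prop :=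
  a22Const (fun x => w₁ x ^ (1 + r)) (fun x => w₂ x ^ (1 + r)) ≤
    (C : ℝ≥0∞) * a22Const w₁ w₂ ^ (1 + r)

end BilinearWeights

end

/-! ### Dyadic subdivision of half-open cubes -/

namespace BilinearWeights

open Filter Topology

variable {n : ℕ}

/-! Sufficiency. Let `T` be the constant of the pair. By Cauchy–Schwarz, `v = w₁^(1/2) w₂^(1/2)` is
an `A_2` weight with constant at most `T`; by Hölder, each `wᵢ⁻¹` is an `A_4` weight with constant
at most `T ^ 2`. Chebyshev then shows that each of these three functions is at least `1 / B` times
its mean on half of every cube, with `B = 2 * T` for `v` and `B = 8 * T ^ 2` for the inverses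
(`isHalfBounded_mul`, `isHalfBounded_inv`). A Calderón–Zygmund stopping argument turns this into a
bound for the mass of superlevel sets (`setLIntegral_superlevel_le`). Integrating that over the
levels gives a reverse Hölder inequality with factor 2 as soon as `δ * 2 ^ (n + 1) * B ^ (1 + δ) ≤ 1
/ 2` (`IsHalfBounded.laverage_rpow_le`). The worst `B` is of order `T ^ 2`, whence `r ≲ T ^ (-2)`.

Necessity. The pairs `(|x i| ^ s, 1)` with `0 ≤ s < 1` have constant comparable to `(1 - s) ^
(-1/2)`, while for `s ≥ 1` the constant is infinite. Any bound (∗), whatever `C` is, therefore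
forces `s * (1 + r) < 1`, that is `r < (1 - s) / s`. The constant is log-convex in `s`, hence
continuous, so every `t ≥ t₀` is attained by some `s` bounded away from 0, and `1 - s ≤ 4 / t ^ 2`
there. -/

/-- The half-open cube with lower corner `a` and side length `l`. -/
def halfOpenCube (a : Fin n → ℝ) (l : ℝ) : Set (Fin n → ℝ) :=
  Set.univ.pi fun i => Set.Ico (a i) (a i + l)

/-- The lower corners of the `2 ^ n` halves of a cube. -/
noncomputable def childCorner (a : Fin n → ℝ) (l : ℝ) (ε : Fin n → Bool) : Fin n → ℝ :=
  fun i => a i + if ε i then l / 2 else 0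

lemma mem_halfOpenCube {a x : Fin n → ℝ} {l : ℝ} :
    x ∈ halfOpenCube a l ↔ ∀ i, a i ≤ x i ∧ x i < a i + l := by
  simp [halfOpenCube]

lemma measurableSet_halfOpenCube (a : Fin n → ℝ) (l : ℝ) : MeasurableSet (halfOpenCube a l) :=
  MeasurableSet.univ_pi fun _ => measurableSet_Ico

lemma halfOpenCube_ae_eq_cube (a : Fin n → ℝ) (l : ℝ) :
    halfOpenCube a l =ᵐ[volume] cube a l :=
  Measure.univ_pi_Ico_ae_eq_Icc

lemma volume_halfOpenCube (a : Fin n → ℝ) (l : ℝ) :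
    volume (halfOpenCube a l) = ENNReal.ofReal l ^ n := by
  simp [halfOpenCube, Real.volume_pi_Ico]

lemma volume_cube (a : Fin n → ℝ) (l : ℝ) : volume (cube a l) = ENNReal.ofReal l ^ n := by
  rw [← measure_congr (halfOpenCube_ae_eq_cube a l), volume_halfOpenCube]

lemma volume_halfOpenCube_eq_two_pow_mul (a b : Fin n → ℝ) {l : ℝ} :
    volume (halfOpenCube a l) = 2 ^ n * volume (halfOpenCube b (l / 2)) := by
  rw [volume_halfOpenCube, volume_halfOpenCube, ← mul_pow]
  congr 1
  rw [← ENNReal.ofReal_ofNat, ← ENNReal.ofReal_mul (by norm_num)]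
  congr 1
  ring

lemma halfOpenCube_childCorner_subset (a : Fin n → ℝ) {l : ℝ} (hl : 0 < l) (ε : Fin n → Bool) :
    halfOpenCube (childCorner a l ε) (l / 2) ⊆ halfOpenCube a l := by
  intro x hx
  rw [mem_halfOpenCube] at hx ⊢
  intro i
  have := hx i
  simp only [childCorner] at this
  split_ifs at this <;> constructor <;> linarith

lemma exists_mem_childCorner {a x : Fin n → ℝ} {l : ℝ} (hx : x ∈ halfOpenCube a l) :
    ∃ ε, x ∈ halfOpenCube (childCorner a l ε) (l / 2) := by
  rw [mem_halfOpenCube] at hx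
  refine ⟨fun i => decide (a i + l / 2 ≤ x i), mem_halfOpenCube.2 fun i => ?_⟩
  have := hx i
  by_cases h : a i + l / 2 ≤ x i
  · simp only [childCorner, decide_eq_true h, if_true]
    constructor <;> linarith
  · simp only [childCorner, decide_eq_false h, Bool.false_eq_true, if_false]
    constructor <;> linarith

lemma pairwise_disjoint_childCorner (a : Fin n → ℝ) (l : ℝ) :
    Pairwise (Function.onFun Disjoint fun ε : Fin n → Bool =>
      halfOpenCube (childCorner a l ε) (l / 2)) := by
  intro ε ε' hne
  rw [Function.onFun, Set.disjoint_left]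
  intro x hx hx'
  obtain ⟨i, hi⟩ := Function.ne_iff.1 hne
  have h := mem_halfOpenCube.1 hx i
  have h' := mem_halfOpenCube.1 hx' i
  simp only [childCorner] at h h'
  cases h1 : ε i <;> cases h2 : ε' i <;> simp_all <;> linarith

open Classical in
/-- The union of the dyadic subcubes, of generation at most `k`, which are maximal for the
property that the average of `w` exceeds `lam`. -/
def stoppingSet (w : (Fin n → ℝ) → ℝ≥0∞) (lam : ℝ≥0∞) : ℕ → (Fin n → ℝ) → ℝ → Set (Fin n → ℝ)
  | 0, _, _ => ∅
  | k + 1, a, l => ⋃ ε : Fin n → Bool,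
      if lam * volume (halfOpenCube (childCorner a l ε) (l / 2)) <
          ∫⁻ x in halfOpenCube (childCorner a l ε) (l / 2), w x
      then halfOpenCube (childCorner a l ε) (l / 2)
      else stoppingSet w lam k (childCorner a l ε) (l / 2)

lemma stoppingSet_mono_succ (w : (Fin n → ℝ) → ℝ≥0∞) (lam : ℝ≥0∞) (k : ℕ) :
    ∀ (a : Fin n → ℝ) (l : ℝ), stoppingSet w lam k a l ⊆ stoppingSet w lam (k + 1) a l := by
  induction k with
  | zero => intro a l; simp [stoppingSet]
  | succ k ih =>
    intro a l
    rw [stoppingSet, stoppingSet]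
    refine Set.iUnion_mono fun ε => ?_
    split_ifs
    · exact subset_rfl
    · exact ih _ _

/-- A cube is selected only when its parent has average at most `lam`, so its mass is at most `2 ^ n
* lam` times its volume, and `S` fills half of it. Disjointness of the children lets these bounds
add up, uniformly in `k`. -/
lemma lintegral_stoppingSet_le {w : (Fin n → ℝ) → ℝ≥0∞} {lam : ℝ≥0∞} {S : Set (Fin n → ℝ)}
    (hS : MeasurableSet S)
    (hhalf : ∀ (a : Fin n → ℝ) (l : ℝ), 0 < l →
      lam * volume (halfOpenCube a l) < ∫⁻ x in halfOpenCube a l, w x →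
      volume (halfOpenCube a l) ≤ 2 * volume (halfOpenCube a l ∩ S)) (k : ℕ) :
    ∀ (a : Fin n → ℝ) (l : ℝ), 0 < l →
      ∫⁻ x in halfOpenCube a l, w x ≤ lam * volume (halfOpenCube a l) →
      ∫⁻ x in stoppingSet w lam k a l, w x ≤ 2 ^ (n + 1) * lam * volume (halfOpenCube a l ∩ S) := by
  induction k with
  | zero => intro a l _ _; simp [stoppingSet]
  | succ k ih =>
    intro a l hl hav
    rw [stoppingSet]
    refine (lintegral_iUnion_le _ _).trans ?_
    have hmeas : ∀ ε : Fin n → Bool,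
        MeasurableSet (halfOpenCube (childCorner a l ε) (l / 2) ∩ S) := fun ε =>
      (measurableSet_halfOpenCube _ _).inter hS
    have hsum : ∑' ε : Fin n → Bool, volume (halfOpenCube (childCorner a l ε) (l / 2) ∩ S) ≤
        volume (halfOpenCube a l ∩ S) := by
      rw [← measure_iUnion (fun ε ε' h => ((pairwise_disjoint_childCorner a l h).mono
        Set.inter_subset_left Set.inter_subset_left)) hmeas]
      refine measure_mono (Set.iUnion_subset fun ε => ?_)
      exact Set.inter_subset_inter_left _ (halfOpenCube_childCorner_subset a hl ε)
    calc _ ≤ ∑' ε : Fin n → Bool, 2 ^ (n + 1) * lam *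
          volume (halfOpenCube (childCorner a l ε) (l / 2) ∩ S) := by
          refine ENNReal.tsum_le_tsum fun ε => ?_
          split_ifs with h
          · calc ∫⁻ x in halfOpenCube (childCorner a l ε) (l / 2), w x
                ≤ ∫⁻ x in halfOpenCube a l, w x :=
                  lintegral_mono_set (halfOpenCube_childCorner_subset a hl ε)
              _ ≤ lam * volume (halfOpenCube a l) := hav
              _ = 2 ^ n * lam * volume (halfOpenCube (childCorner a l ε) (l / 2)) := by
                  rw [volume_halfOpenCube_eq_two_pow_mul a (childCorner a l ε)]; ring
              _ ≤ 2 ^ n * lam * (2 * volume (halfOpenCube (childCorner a l ε) (l / 2) ∩ S)) := by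
                  gcongr
                  exact hhalf _ _ (by positivity) h
              _ = _ := by ring
          · exact ih _ _ (by positivity) (not_lt.1 h)
      _ ≤ _ := by
          rw [ENNReal.tsum_mul_left]
          gcongr

/-- A point that escapes selection lies in unselected cubes of every generation; these feed the
differentiation theorem. -/
lemma exists_subcube_of_forall_notMem_stoppingSet {w : (Fin n → ℝ) → ℝ≥0∞} {lam : ℝ≥0∞}
    {x : Fin n → ℝ} (k : ℕ) :
    ∀ (a : Fin n → ℝ) (l : ℝ), 0 < l →
      ∫⁻ y in halfOpenCube a l, w y ≤ lam * volume (halfOpenCube a l) →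
      x ∈ halfOpenCube a l → x ∉ stoppingSet w lam k a l →
      ∃ b, x ∈ halfOpenCube b (l / 2 ^ k) ∧ halfOpenCube b (l / 2 ^ k) ⊆ halfOpenCube a l ∧
        ∫⁻ y in halfOpenCube b (l / 2 ^ k), w y ≤ lam * volume (halfOpenCube b (l / 2 ^ k)) := by
  induction k with
  | zero =>
    intro a l _ hav hx _
    exact ⟨a, by simpa using hx, by simp, by simpa using hav⟩
  | succ k ih =>
    intro a l hl hav hx hnot
    obtain ⟨ε, hε⟩ := exists_mem_childCorner hx
    rw [stoppingSet, Set.mem_iUnion, not_exists] at hnot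
    have hn := hnot ε
    split_ifs at hn with h
    · exact absurd hε hn
    obtain ⟨b, hb, hsub, hbav⟩ := ih _ _ (by positivity) (not_lt.1 h) hε hn
    have e : l / 2 / 2 ^ k = l / 2 ^ (k + 1) := by rw [pow_succ']; field_simp
    rw [e] at hb hsub hbav
    exact ⟨b, hb, hsub.trans (halfOpenCube_childCorner_subset a hl ε), hbav⟩

/-- Balls of the sup norm are cubes, which makes differentiation along balls available. -/
lemma halfOpenCube_ae_eq_closedBall (b : Fin n → ℝ) {l : ℝ} (hl : 0 ≤ l) :
    halfOpenCube b l =ᵐ[volume] Metric.closedBall (fun i => b i + l / 2) (l / 2) := by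
  refine (halfOpenCube_ae_eq_cube b l).trans (Filter.EventuallyEq.of_eq ?_)
  rw [closedBall_pi _ (by positivity), cube, ← Set.pi_univ_Icc]
  refine Set.pi_congr rfl fun i _ => ?_
  rw [Real.closedBall_eq_Icc]
  congr 1 <;> ring

lemma ae_mem_iUnion_stoppingSet {w : (Fin n → ℝ) → ℝ≥0∞} (hw : Measurable w) {lam : ℝ≥0∞}
    (hlam : lam ≠ ∞) {a : Fin n → ℝ} {l : ℝ} (hl : 0 < l)
    (hav : ∫⁻ x in halfOpenCube a l, w x ≤ lam * volume (halfOpenCube a l)) :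
    ∀ᵐ x, x ∈ halfOpenCube a l → lam < w x → x ∈ ⋃ k, stoppingSet w lam k a l := by
  have hQ := measurableSet_halfOpenCube a l
  -- Differentiation is applied to a function of finite total integral, hence the cut-off to the
  -- cube.
  have hfin : ∫⁻ x, (halfOpenCube a l).indicator w x ≠ ∞ := by
    rw [lintegral_indicator hQ]
    refine ne_top_of_le_ne_top ?_ hav
    rw [volume_halfOpenCube]
    exact ENNReal.mul_ne_top hlam (by finiteness)
  -- The parameter 1 allows balls that contain `x` without being centred at it.
  filter_upwards [(IsUnifLocDoublingMeasure.vitaliFamily (volume : Measure (Fin n → ℝ))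
    1).ae_tendsto_lintegral_div (hw.indicator hQ).aemeasurable hfin] with x hx hxQ hlt
  by_contra hnot
  rw [Set.mem_iUnion, not_exists] at hnot
  choose b hb hsub hbav using fun k =>
    exists_subcube_of_forall_notMem_stoppingSet k a l hl hav hxQ (hnot k)
  have hδ : Tendsto (fun k : ℕ => l / 2 ^ k / 2) atTop (𝓝[>] 0) := by
    refine tendsto_nhdsWithin_iff.2 ⟨?_, Eventually.of_forall fun k => by
      simp only [Set.mem_Ioi]; positivity⟩
    have := ((tendsto_pow_atTop_nhds_zero_of_lt_one (r := (1 / 2 : ℝ)) (by norm_num)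
      (by norm_num)).const_mul l).div_const 2
    simpa [div_eq_mul_inv] using this
  have hmem : ∀ᶠ k : ℕ in atTop, x ∈ Metric.closedBall
      ((fun i => b k i + l / 2 ^ k / 2 : Fin n → ℝ)) (1 * (l / 2 ^ k / 2)) := by
    refine Eventually.of_forall fun k => ?_
    rw [one_mul, closedBall_pi _ (by positivity)]
    intro i _
    have := mem_halfOpenCube.1 (hb k) i
    simp only [Real.closedBall_eq_Icc]
    constructor <;> linarith
  have hlim := hx.comp (IsUnifLocDoublingMeasure.tendsto_closedBall_filterAt volume
    (fun k i => b k i + l / 2 ^ k / 2) (fun k : ℕ => l / 2 ^ k / 2) hδ hmem)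
  rw [Set.indicator_of_mem hxQ] at hlim
  refine absurd (le_of_tendsto hlim (Eventually.of_forall fun k => ?_)) (not_le.2 hlt)
  have hae := halfOpenCube_ae_eq_closedBall (b k) (l := l / 2 ^ k) (by positivity)
  simp only [Function.comp]
  rw [← setLIntegral_congr hae, ← measure_congr hae]
  refine ENNReal.div_le_of_le_mul (le_trans (lintegral_mono fun y => ?_) (hbav k))
  exact Set.indicator_le_self _ _ _

/-- A Calderón–Zygmund estimate: if `S` fills at least half of every cube on which the average of
`w` exceeds `lam`, then the `w`-mass of `{lam < w}` in a cube of average at most `lam` is controlled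
by the measure of `S` in that cube. -/
lemma setLIntegral_superlevel_le {w : (Fin n → ℝ) → ℝ≥0∞} (hw : Measurable w) {lam : ℝ≥0∞}
    (hlam : lam ≠ ∞) {S : Set (Fin n → ℝ)} (hS : MeasurableSet S)
    (hhalf : ∀ (a : Fin n → ℝ) (l : ℝ), 0 < l →
      lam * volume (halfOpenCube a l) < ∫⁻ x in halfOpenCube a l, w x →
      volume (halfOpenCube a l) ≤ 2 * volume (halfOpenCube a l ∩ S))
    {a : Fin n → ℝ} {l : ℝ} (hl : 0 < l)
    (hav : ∫⁻ x in halfOpenCube a l, w x ≤ lam * volume (halfOpenCube a l)) :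
    ∫⁻ x in halfOpenCube a l ∩ {x | lam < w x}, w x ≤
      2 ^ (n + 1) * lam * volume (halfOpenCube a l ∩ S) := by
  have hle : ∫⁻ x in halfOpenCube a l ∩ {x | lam < w x}, w x ≤
      ∫⁻ x in ⋃ k, stoppingSet w lam k a l, w x := by
    refine lintegral_mono_set' ?_
    filter_upwards [ae_mem_iUnion_stoppingSet hw hlam hl hav] with x hx hx'
    exact hx hx'.1 hx'.2
  refine hle.trans ?_
  rw [setLIntegral_iUnion_of_directed _ (monotone_nat_of_le_succ fun k =>
    stoppingSet_mono_succ w lam k a l).directed_le]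
  exact iSup_le fun k => lintegral_stoppingSet_le hS hhalf k a l hl hav

/-! ### The reverse Hölder inequality -/

lemma volume_halfOpenCube_ne_zero (a : Fin n → ℝ) {l : ℝ} (hl : 0 < l) :
    volume (halfOpenCube a l) ≠ 0 := by
  rw [volume_halfOpenCube]
  exact pow_ne_zero _ (by simpa using hl)

lemma volume_halfOpenCube_ne_top (a : Fin n → ℝ) (l : ℝ) :
    volume (halfOpenCube a l) ≠ ∞ := by
  rw [volume_halfOpenCube]
  finiteness

/-- The functions `w` such that `w` is locally integrable and, on at least half of every cube,
at least `1 / B` times its average over this cube. -/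
structure IsHalfBounded (w : (Fin n → ℝ) → ℝ≥0∞) (B : ℝ) : Prop where
  measurable : Measurable w
  lintegral_ne_top : ∀ (a : Fin n → ℝ) (l : ℝ), 0 < l → ∫⁻ x in halfOpenCube a l, w x ≠ ∞
  volume_le : ∀ (a : Fin n → ℝ) (l : ℝ), 0 < l → volume (halfOpenCube a l) ≤
    2 * volume (halfOpenCube a l ∩ {x | (⨍⁻ y in halfOpenCube a l, w y ∂volume) ≤ ENNReal.ofReal B * w x})

/-- The truncation of `w` at height `N`, as a real function. -/
def truncation (w : (Fin n → ℝ) → ℝ≥0∞) (N : ℕ) (x : Fin n → ℝ) : ℝ := (min (w x) N).toReal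

lemma truncation_nonneg (w : (Fin n → ℝ) → ℝ≥0∞) (N : ℕ) (x : Fin n → ℝ) :
    0 ≤ truncation w N x := ENNReal.toReal_nonneg

lemma measurable_truncation {w : (Fin n → ℝ) → ℝ≥0∞} (hw : Measurable w) (N : ℕ) :
    Measurable (truncation w N) := (hw.min measurable_const).ennreal_toReal

lemma ofReal_truncation (w : (Fin n → ℝ) → ℝ≥0∞) (N : ℕ) (x : Fin n → ℝ) :
    ENNReal.ofReal (truncation w N x) = min (w x) N :=
  ENNReal.ofReal_toReal (ne_top_of_le_ne_top (ENNReal.natCast_ne_top N) (min_le_right _ _))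

lemma truncation_le (w : (Fin n → ℝ) → ℝ≥0∞) (N : ℕ) (x : Fin n → ℝ) :
    truncation w N x ≤ N :=
  ENNReal.toReal_le_of_le_ofReal (by positivity) (by simp)

/-- Where the mean exceeds `lam`, the half of the cube on which `B * w` dominates the mean lies in
`{lam ≤ B * w}`. -/
lemma IsHalfBounded.setLIntegral_superlevel_le {w : (Fin n → ℝ) → ℝ≥0∞} {B : ℝ}
    (h : IsHalfBounded w B) {lam : ℝ≥0∞} (hlam : lam ≠ ∞) {a : Fin n → ℝ} {l : ℝ} (hl : 0 < l)
    (hav : ∫⁻ x in halfOpenCube a l, w x ≤ lam * volume (halfOpenCube a l)) :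
    ∫⁻ x in halfOpenCube a l ∩ {x | lam < w x}, w x ≤
      2 ^ (n + 1) * lam * volume (halfOpenCube a l ∩ {x | lam ≤ ENNReal.ofReal B * w x}) := by
  refine BilinearWeights.setLIntegral_superlevel_le h.measurable hlam
    (measurableSet_le measurable_const (h.measurable.const_mul _)) (fun a l hl hlt => ?_) hl hav
  refine (h.volume_le a l hl).trans ?_
  gcongr
  rw [setLAverage_eq, ENNReal.le_div_iff_mul_le (Or.inl (volume_halfOpenCube_ne_zero a hl))
    (Or.inl (volume_halfOpenCube_ne_top a l))]
  exact hlt.le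

/-- For `t` below the mean the first summand is already the whole mass; for larger `t` it vanishes
and the superlevel estimate takes over. -/
lemma IsHalfBounded.withDensity_truncation_le {w : (Fin n → ℝ) → ℝ≥0∞} {B : ℝ}
    (h : IsHalfBounded w B) (hB : 1 ≤ B) (a : Fin n → ℝ) {l : ℝ} (hl : 0 < l) (N : ℕ) {t : ℝ}
    (ht : 0 < t) :
    (volume.restrict (halfOpenCube a l)).withDensity w {x | t < truncation w N x} ≤
      (volume.restrict (halfOpenCube a l)).withDensity w
          {_x | t < (⨍⁻ y in halfOpenCube a l, w y ∂volume).toReal} +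
        2 ^ (n + 1) * ENNReal.ofReal t *
          volume.restrict (halfOpenCube a l) {x | t ≤ B * truncation w N x} := by
  rcases lt_or_ge t (⨍⁻ y in halfOpenCube a l, w y ∂volume).toReal with hm | hm
  · refine le_add_right (measure_mono fun x _ => hm)
  refine le_add_left ?_
  rcases le_or_gt (N : ℝ) t with hN | hN
  · have : {x | t < truncation w N x} = ∅ := by
      ext x
      simpa using (truncation_le w N x).trans hN
    simp [this]
  have hQ := measurableSet_halfOpenCube a l
  have hV0 := volume_halfOpenCube_ne_zero a hl
  have hVt := volume_halfOpenCube_ne_top a l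
  have hav : ∫⁻ x in halfOpenCube a l, w x ≤ ENNReal.ofReal t * volume (halfOpenCube a l) := by
    rw [setLAverage_eq] at hm
    rw [← ENNReal.div_le_iff hV0 hVt]
    exact (ENNReal.le_ofReal_iff_toReal_le
      (ENNReal.div_ne_top (h.lintegral_ne_top a l hl) hV0) ht.le).2 hm
  have hmeas : MeasurableSet {x | ENNReal.ofReal t < w x} :=
    measurableSet_lt measurable_const h.measurable
  calc _ ≤ (volume.restrict (halfOpenCube a l)).withDensity w {x | ENNReal.ofReal t < w x} := by
        refine measure_mono fun x hx => ?_
        have hx' : t < truncation w N x := hx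
        have := (ENNReal.ofReal_lt_ofReal_iff (ht.trans hx')).2 hx'
        rw [ofReal_truncation] at this
        exact this.trans_le (min_le_left _ _)
    _ = ∫⁻ x in halfOpenCube a l ∩ {x | ENNReal.ofReal t < w x}, w x := by
        rw [withDensity_apply _ hmeas, Measure.restrict_restrict hmeas, Set.inter_comm]
    _ ≤ _ := h.setLIntegral_superlevel_le ENNReal.ofReal_ne_top hl hav
    _ ≤ _ := by
        rw [Measure.restrict_apply (measurableSet_le measurable_const
          ((measurable_truncation h.measurable N).const_mul B)), Set.inter_comm]
        gcongr 2 ^ (n + 1) * _ * volume ?_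
        refine Set.inter_subset_inter_left _ fun x hx => ?_
        have hx' : ENNReal.ofReal t ≤ ENNReal.ofReal B * w x := hx
        change t ≤ B * truncation w N x
        refine (ENNReal.ofReal_le_ofReal_iff
          (mul_nonneg (by linarith) (truncation_nonneg w N x))).1 ?_
        rw [ENNReal.ofReal_mul (by linarith), ofReal_truncation]
        -- Truncation does not spoil the level set: where `w` exceeds `N`, the bounds `t < N` and `1
        -- ≤ B` suffice.
        rcases le_total (w x) N with hle | hle
        · rwa [min_eq_left hle]
        · rw [min_eq_right hle]
          calc ENNReal.ofReal t ≤ ENNReal.ofReal N := ENNReal.ofReal_le_ofReal hN.le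
            _ = 1 * (N : ℝ≥0∞) := by simp
            _ ≤ _ := by
              gcongr
              simpa using ENNReal.ofReal_le_ofReal hB

lemma le_two_mul_of_le_add_half {F A : ℝ≥0∞} (hF : F ≠ ∞) (h : F ≤ A + 2⁻¹ * F) : F ≤ 2 * A := by
  by_cases hA : A = ∞
  · simp [hA]
  lift F to ℝ≥0 using hF
  lift A to ℝ≥0 using hA
  have h2 : (2⁻¹ : ℝ≥0∞) = ((2⁻¹ : ℝ≥0) : ℝ≥0∞) := by simp
  rw [h2] at h
  norm_cast at h ⊢
  have h' : (F : ℝ) ≤ A + 2⁻¹ * F := by exact_mod_cast h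
  have : (F : ℝ) ≤ 2 * A := by linarith
  exact_mod_cast this

/-- Layer-cake in the measure `w dx`: the levels below the mean give the main term, and the others
return the left side times at most one half, which is absorbed. -/
lemma IsHalfBounded.lintegral_truncation_rpow_mul_le {w : (Fin n → ℝ) → ℝ≥0∞} {B : ℝ}
    (h : IsHalfBounded w B) (hB : 1 ≤ B) (a : Fin n → ℝ) {l : ℝ} (hl : 0 < l) (N : ℕ) {δ : ℝ}
    (hδ : 0 < δ) (hδB : δ * 2 ^ (n + 1) * B ^ (1 + δ) ≤ 1 / 2) :
    ∫⁻ x in halfOpenCube a l, (min (w x) N) ^ δ * w x ≤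
      2 * ((⨍⁻ y in halfOpenCube a l, w y ∂volume) ^ δ * ∫⁻ x in halfOpenCube a l, w x) := by
  set vQ := volume.restrict (halfOpenCube a l) with hvQ
  set ν := vQ.withDensity w with hν
  set m := (⨍⁻ y in halfOpenCube a l, w y ∂volume).toReal with hm
  have hfm := measurable_truncation h.measurable N
  have hmtop : (⨍⁻ y in halfOpenCube a l, w y ∂volume) ≠ ∞ := by
    rw [setLAverage_eq]
    exact ENNReal.div_ne_top (h.lintegral_ne_top a l hl) (volume_halfOpenCube_ne_zero a hl)
  have hνuniv : ν Set.univ = ∫⁻ x in halfOpenCube a l, w x := by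
    rw [hν, withDensity_apply _ MeasurableSet.univ, Measure.restrict_univ]
  have hpow : ∀ x, ENNReal.ofReal (truncation w N x ^ δ) = (min (w x) N) ^ δ := fun x => by
    rw [← ENNReal.ofReal_rpow_of_nonneg (truncation_nonneg w N x) hδ.le, ofReal_truncation]
  have hF : ∫⁻ x, ENNReal.ofReal (truncation w N x ^ δ) ∂ν =
      ∫⁻ x in halfOpenCube a l, (min (w x) N) ^ δ * w x := by
    rw [hν, lintegral_withDensity_eq_lintegral_mul _ h.measurable (by fun_prop)]
    refine lintegral_congr fun x => ?_
    rw [Pi.mul_apply, hpow, mul_comm]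
  have hM : ∫⁻ _x, ENNReal.ofReal (m ^ δ) ∂ν =
      (⨍⁻ y in halfOpenCube a l, w y ∂volume) ^ δ * ∫⁻ x in halfOpenCube a l, w x := by
    rw [lintegral_const, hνuniv, hm, ← ENNReal.ofReal_rpow_of_nonneg ENNReal.toReal_nonneg hδ.le,
      ENNReal.ofReal_toReal hmtop]
  -- Absorption needs a finite quantity; this is the purpose of truncating.
  have hFtop : ∫⁻ x in halfOpenCube a l, (min (w x) N) ^ δ * w x ≠ ∞ := by
    refine ne_top_of_le_ne_top (b := (N : ℝ≥0∞) ^ δ * ∫⁻ x in halfOpenCube a l, w x)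
      (ENNReal.mul_ne_top (by finiteness) (h.lintegral_ne_top a l hl)) ?_
    rw [← lintegral_const_mul _ h.measurable]
    refine lintegral_mono fun x => ?_
    gcongr
    exact min_le_right _ _
  refine le_two_mul_of_le_add_half hFtop ?_
  have htail : ∫⁻ t in Set.Ioi (0 : ℝ), vQ {x | t ≤ B * truncation w N x} *
      ENNReal.ofReal (t ^ (1 + δ - 1)) ≤ ENNReal.ofReal (B ^ (1 + δ)) *
        ∫⁻ x in halfOpenCube a l, (min (w x) N) ^ δ * w x := by
    have key := lintegral_rpow_eq_lintegral_meas_le_mul vQ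
      (f := fun x => B * truncation w N x)
      (Eventually.of_forall fun x => mul_nonneg (by linarith) (truncation_nonneg w N x))
      (by fun_prop) (p := 1 + δ) (by linarith)
    calc _ ≤ ENNReal.ofReal (1 + δ) * ∫⁻ t in Set.Ioi (0 : ℝ), vQ {x | t ≤ B * truncation w N x} *
          ENNReal.ofReal (t ^ (1 + δ - 1)) := by
          refine le_mul_of_one_le_left (by positivity) ?_
          simpa using ENNReal.ofReal_le_ofReal (show (1 : ℝ) ≤ 1 + δ by linarith)
      _ = _ := key.symm
      _ ≤ ∫⁻ x in halfOpenCube a l, ENNReal.ofReal (B ^ (1 + δ)) * ((min (w x) N) ^ δ * w x) := by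
          refine lintegral_mono fun x => ?_
          have hf0 := truncation_nonneg w N x
          simp only
          rw [Real.mul_rpow (by linarith) hf0, ENNReal.ofReal_mul (by positivity), add_comm 1 δ,
            Real.rpow_add_one' hf0 (by linarith), ENNReal.ofReal_mul (by positivity), hpow,
            ofReal_truncation]
          gcongr
          exact min_le_left _ _
      _ = _ := lintegral_const_mul' _ _ ENNReal.ofReal_ne_top
  calc ∫⁻ x in halfOpenCube a l, (min (w x) N) ^ δ * w x
      = ENNReal.ofReal δ * ∫⁻ t in Set.Ioi (0 : ℝ), ν {x | t < truncation w N x} *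
          ENNReal.ofReal (t ^ (δ - 1)) := by
        rw [← hF]
        exact lintegral_rpow_eq_lintegral_meas_lt_mul ν
          (Eventually.of_forall fun x => truncation_nonneg w N x) hfm.aemeasurable hδ
    _ ≤ ENNReal.ofReal δ * ∫⁻ t in Set.Ioi (0 : ℝ), (ν {_x | t < m} * ENNReal.ofReal (t ^ (δ - 1)) +
          2 ^ (n + 1) * (vQ {x | t ≤ B * truncation w N x} *
            ENNReal.ofReal (t ^ (1 + δ - 1)))) := by
        gcongr ENNReal.ofReal δ * ?_
        refine setLIntegral_mono' measurableSet_Ioi fun t ht => ?_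
        have ht' : 0 < t := ht
        have hexp : t ^ (1 + δ - 1) = t * t ^ (δ - 1) := by
          rw [show 1 + δ - 1 = 1 + (δ - 1) by ring, Real.rpow_add ht', Real.rpow_one]
        rw [hexp, ENNReal.ofReal_mul ht'.le]
        calc _ ≤ _ := mul_le_mul_left (h.withDensity_truncation_le hB a hl N ht') _
          _ = _ := by ring
    _ = ENNReal.ofReal δ * (∫⁻ t in Set.Ioi (0 : ℝ), ν {_x | t < m} * ENNReal.ofReal (t ^ (δ - 1))) +
        ENNReal.ofReal δ * (2 ^ (n + 1) * ∫⁻ t in Set.Ioi (0 : ℝ),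
          vQ {x | t ≤ B * truncation w N x} * ENNReal.ofReal (t ^ (1 + δ - 1))) := by
        rw [lintegral_add_left, lintegral_const_mul' _ _ (by finiteness), mul_add]
        refine Measurable.mul ?_ (by fun_prop)
        refine Antitone.measurable fun s t hst => measure_mono fun x hx => ?_
        exact lt_of_le_of_lt hst hx
    _ ≤ _ := by
        rw [← lintegral_rpow_eq_lintegral_meas_lt_mul ν (f := fun _ => m)
          (Eventually.of_forall fun x => ENNReal.toReal_nonneg) (by fun_prop) hδ, hM]
        refine add_le_add le_rfl ?_
        calc _ ≤ ENNReal.ofReal δ * (2 ^ (n + 1) * (ENNReal.ofReal (B ^ (1 + δ)) *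
              ∫⁻ x in halfOpenCube a l, (min (w x) N) ^ δ * w x)) := by gcongr
          _ = ENNReal.ofReal (δ * 2 ^ (n + 1) * B ^ (1 + δ)) *
              ∫⁻ x in halfOpenCube a l, (min (w x) N) ^ δ * w x := by
              rw [ENNReal.ofReal_mul (by positivity), ENNReal.ofReal_mul hδ.le,
                ENNReal.ofReal_pow (by norm_num), ENNReal.ofReal_ofNat]
              ring
          _ ≤ _ := by
              gcongr
              rw [← ENNReal.ofReal_ofNat, ← ENNReal.ofReal_inv_of_pos (by norm_num)]
              exact ENNReal.ofReal_le_ofReal (by linarith)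

/-- The reverse Hölder inequality. -/
lemma IsHalfBounded.laverage_rpow_le {w : (Fin n → ℝ) → ℝ≥0∞} {B : ℝ}
    (h : IsHalfBounded w B) (hB : 1 ≤ B) (a : Fin n → ℝ) {l : ℝ} (hl : 0 < l) {δ : ℝ}
    (hδ : 0 < δ) (hδB : δ * 2 ^ (n + 1) * B ^ (1 + δ) ≤ 1 / 2) :
    (⨍⁻ x in halfOpenCube a l, w x ^ (1 + δ) ∂volume) ≤
      2 * (⨍⁻ x in halfOpenCube a l, w x ∂volume) ^ (1 + δ) := by
  have hlim : Tendsto (fun N : ℕ => ∫⁻ x in halfOpenCube a l, (min (w x) N) ^ δ * w x) atTop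
      (𝓝 (∫⁻ x in halfOpenCube a l, w x ^ δ * w x)) := by
    have hw := h.measurable
    refine lintegral_tendsto_of_tendsto_of_monotone (fun N => by fun_prop)
      (Eventually.of_forall fun x N N' hNN => ?_) (Eventually.of_forall fun x => ?_)
    · simp only
      gcongr
    · have h1 : Tendsto (fun N : ℕ => min (w x) (N : ℝ≥0∞)) atTop (𝓝 (w x)) := by
        simpa using tendsto_const_nhds.min ENNReal.tendsto_nat_nhds_top
      rcases eq_or_ne (w x) 0 with h0 | h0
      · simp [h0]
      · refine ENNReal.Tendsto.mul_const ((ENNReal.continuous_rpow_const.tendsto _).comp h1)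
          (Or.inl ?_)
        simp [h0, hδ.not_gt]
  have hle := le_of_tendsto hlim (Eventually.of_forall fun N =>
    h.lintegral_truncation_rpow_mul_le hB a hl N hδ hδB)
  have hsplit : ∀ y : ℝ≥0∞, y ^ (1 + δ) = y ^ δ * y := fun y => by
    rw [ENNReal.rpow_add_of_nonneg _ _ zero_le_one hδ.le, ENNReal.rpow_one, mul_comm]
  simp only [hsplit]
  rw [setLAverage_eq _ (fun x => w x ^ δ * w x)]
  refine (ENNReal.div_le_div_right hle _).trans_eq ?_
  rw [mul_div_assoc, mul_div_assoc]
  congr 2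
  rw [setLAverage_eq]

/-! ### The sufficient condition -/

/-- Hölder's inequality for the normalised measure to which `laverage` unfolds. -/
lemma laverage_mul_rpow_le {α : Type*} [MeasurableSpace α] {μ : Measure α} {f g : α → ℝ≥0∞}
    (hf : Measurable f) (hg : Measurable g) {p q : ℝ} (hp : 0 ≤ p) (hq : 0 ≤ q) (hpq : p + q = 1) :
    (⨍⁻ x, f x ^ p * g x ^ q ∂μ) ≤ (⨍⁻ x, f x ∂μ) ^ p * (⨍⁻ x, g x ∂μ) ^ q :=
  ENNReal.lintegral_mul_norm_pow_le hf.aemeasurable hg.aemeasurable hp hq hpq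

lemma setLAverage_congr_ae {α : Type*} [MeasurableSpace α] {μ : Measure α} {f g : α → ℝ≥0∞}
    (s : Set α) (h : f =ᵐ[μ] g) : (⨍⁻ x in s, f x ∂μ) = ⨍⁻ x in s, g x ∂μ :=
  laverage_congr (ae_restrict_of_ae h)

lemma setLAverage_cube (f : (Fin n → ℝ) → ℝ≥0∞) (a : Fin n → ℝ) (l : ℝ) :
    (⨍⁻ x in cube a l, f x ∂volume) = ⨍⁻ x in halfOpenCube a l, f x ∂volume :=
  (setLAverage_congr (halfOpenCube_ae_eq_cube a l)).symm

lemma setLAverage_halfOpenCube_ne_zero {f : (Fin n → ℝ) → ℝ≥0∞} (hf : Measurable f)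
    (hpos : ∀ᵐ x, f x ≠ 0) (a : Fin n → ℝ) {l : ℝ} (hl : 0 < l) :
    (⨍⁻ x in halfOpenCube a l, f x ∂volume) ≠ 0 := by
  rw [setLAverage_eq]
  refine (ENNReal.div_pos ?_ (volume_halfOpenCube_ne_top a l)).ne'
  rw [Ne, lintegral_eq_zero_iff hf]
  intro h0
  have : ∀ᵐ x ∂(volume.restrict (halfOpenCube a l)), False := by
    filter_upwards [h0, ae_restrict_of_ae hpos] with x hx hx'
    exact hx' hx
  rw [ae_iff] at this
  simp [volume_halfOpenCube_ne_zero a hl] at this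

/-- An `A_p` weight, `q = 1 / (p - 1)`, is comparable from below to its averages on half of every
cube. -/
lemma isHalfBounded_of_laverage_mul_le {w : (Fin n → ℝ) → ℝ≥0∞} (hw : Measurable w) {q A B : ℝ}
    (hq : 0 < q) (hA : 0 < A) (hAB : 2 * ENNReal.ofReal A ^ q ≤ ENNReal.ofReal B ^ q)
    (hfin : ∀ (a : Fin n → ℝ) (l : ℝ), 0 < l → (⨍⁻ x in halfOpenCube a l, w x ∂volume) ≠ ∞)
    (hle : ∀ (a : Fin n → ℝ) (l : ℝ), 0 < l → (⨍⁻ x in halfOpenCube a l, w x ∂volume) ^ q *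
      (⨍⁻ x in halfOpenCube a l, (w x ^ q)⁻¹ ∂volume) ≤ ENNReal.ofReal A ^ q) :
    IsHalfBounded w B := by
  refine ⟨hw, fun a l hl => ?_, fun a l hl => ?_⟩
  · have := hfin a l hl
    rw [setLAverage_eq] at this
    exact fun h => this (by rw [h, ENNReal.top_div_of_ne_top (volume_halfOpenCube_ne_top a l)])
  have hVt := volume_halfOpenCube_ne_top a l
  have hV0 := volume_halfOpenCube_ne_zero a hl
  have hm := hfin a l hl
  have hle' := hle a l hl
  set m := ⨍⁻ x in halfOpenCube a l, w x ∂volume with hmdef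
  have hSmeas : MeasurableSet {x | m ≤ ENNReal.ofReal B * w x} :=
    measurableSet_le measurable_const (hw.const_mul _)
  have hA0 : ENNReal.ofReal A ^ q ≠ 0 := by
    simp [hA, hq.not_gt]
  have hAt : ENNReal.ofReal A ^ q ≠ ∞ := by finiteness
  -- Chebyshev: off the good set `m ^ q * (w x ^ q)⁻¹` is at least `B ^ q`, hence at least `2 * A ^
  -- q`, while its mean is at most `A ^ q`.
  have hD : 2 * volume (halfOpenCube a l \ {x | m ≤ ENNReal.ofReal B * w x}) ≤
      volume (halfOpenCube a l) := by
    have h1 : 2 * ENNReal.ofReal A ^ q *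
        volume (halfOpenCube a l \ {x | m ≤ ENNReal.ofReal B * w x}) ≤
        ENNReal.ofReal A ^ q * volume (halfOpenCube a l) := by
      calc _ ≤ ENNReal.ofReal B ^ q *
            volume (halfOpenCube a l \ {x | m ≤ ENNReal.ofReal B * w x}) := by gcongr
        _ = ∫⁻ x in halfOpenCube a l \ {x | m ≤ ENNReal.ofReal B * w x}, ENNReal.ofReal B ^ q := by
            rw [setLIntegral_const]
        _ ≤ ∫⁻ x in halfOpenCube a l \ {x | m ≤ ENNReal.ofReal B * w x}, m ^ q * (w x ^ q)⁻¹ := by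
            refine setLIntegral_mono' ((measurableSet_halfOpenCube a l).diff hSmeas) fun x hx => ?_
            have hlt : ENNReal.ofReal B * w x < m := not_le.1 hx.2
            have hm0 : m ^ q ≠ 0 := by simp [(pos_of_gt hlt).ne', hq.not_gt]
            rw [← div_eq_mul_inv, ENNReal.le_div_iff_mul_le (Or.inr hm0)
              (Or.inr (by finiteness)), ← ENNReal.mul_rpow_of_nonneg _ _ hq.le]
            gcongr
        _ ≤ ∫⁻ x in halfOpenCube a l, m ^ q * (w x ^ q)⁻¹ := lintegral_mono_set Set.sdiff_subset
        _ = m ^ q * ∫⁻ x in halfOpenCube a l, (w x ^ q)⁻¹ := by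
            rw [lintegral_const_mul' _ _ (by finiteness)]
        _ = m ^ q * (⨍⁻ x in halfOpenCube a l, (w x ^ q)⁻¹ ∂volume) *
              volume (halfOpenCube a l) := by
            rw [setLAverage_eq, mul_assoc, ENNReal.div_mul_cancel hV0 hVt]
        _ ≤ _ := by gcongr
    rw [mul_comm 2, mul_assoc] at h1
    exact (ENNReal.mul_le_mul_iff_right hA0 hAt).1 h1
  refine le_two_mul_of_le_add_half hVt ?_
  calc volume (halfOpenCube a l) = volume (halfOpenCube a l ∩ {x | m ≤ ENNReal.ofReal B * w x}) +
        volume (halfOpenCube a l \ {x | m ≤ ENNReal.ofReal B * w x}) :=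
        (measure_inter_add_sdiff _ hSmeas).symm
    _ ≤ _ := by
        gcongr
        rw [mul_comm, ← div_eq_mul_inv, ENNReal.le_div_iff_mul_le (by simp) (by simp), mul_comm]
        exact hD

lemma one_le_laverage_mul_laverage_inv {v : (Fin n → ℝ) → ℝ≥0∞} (hv : Measurable v)
    (hv0 : ∀ᵐ x, v x ≠ 0) (hvt : ∀ᵐ x, v x ≠ ∞) (a : Fin n → ℝ) {l : ℝ} (hl : 0 < l) :
    1 ≤ (⨍⁻ x in halfOpenCube a l, v x ∂volume) *
      (⨍⁻ x in halfOpenCube a l, (v x)⁻¹ ∂volume) := by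
  have h := laverage_mul_rpow_le (μ := volume.restrict (halfOpenCube a l)) hv hv.inv
    (p := 1 / 2) (q := 1 / 2) (by norm_num) (by norm_num) (by norm_num)
  rw [← ENNReal.mul_rpow_of_nonneg _ _ (by norm_num)] at h
  have h1 : (⨍⁻ x in halfOpenCube a l, v x ^ (1 / 2 : ℝ) * (v⁻¹ x) ^ (1 / 2 : ℝ) ∂volume) = 1 := by
    rw [setLAverage_congr_ae (g := fun _ => 1), setLAverage_const
      (volume_halfOpenCube_ne_zero a hl) (volume_halfOpenCube_ne_top a l)]
    filter_upwards [hv0, hvt] with x h0 ht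
    rw [← ENNReal.mul_rpow_of_nonneg _ _ (by norm_num), Pi.inv_apply, ENNReal.mul_inv_cancel h0 ht,
      ENNReal.one_rpow]
  rw [h1] at h
  by_contra hlt
  exact absurd (ENNReal.rpow_lt_one (not_le.1 hlt) (by norm_num : (0 : ℝ) < 1 / 2)) (not_lt.2 h)

/-- The averages entering the definition of `a22Const`, for measurable functions with values in
`[0, ∞]`. -/
structure IsPairBound (g₁ g₂ : (Fin n → ℝ) → ℝ≥0∞) (T : ℝ) : Prop where
  measurable_left : Measurable g₁
  measurable_right : Measurable g₂
  left_ne_zero : ∀ᵐ x, g₁ x ≠ 0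
  right_ne_zero : ∀ᵐ x, g₂ x ≠ 0
  left_ne_top : ∀ᵐ x, g₁ x ≠ ∞
  right_ne_top : ∀ᵐ x, g₂ x ≠ ∞
  le : ∀ (a : Fin n → ℝ) (l : ℝ), 0 < l →
    (⨍⁻ x in halfOpenCube a l, g₁ x ^ (1 / 2 : ℝ) * g₂ x ^ (1 / 2 : ℝ) ∂volume) *
      (⨍⁻ x in halfOpenCube a l, (g₁ x)⁻¹ ∂volume) ^ (1 / 2 : ℝ) *
      (⨍⁻ x in halfOpenCube a l, (g₂ x)⁻¹ ∂volume) ^ (1 / 2 : ℝ) ≤ ENNReal.ofReal T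

namespace IsPairBound

variable {g₁ g₂ : (Fin n → ℝ) → ℝ≥0∞} {T : ℝ}

lemma symm (h : IsPairBound g₁ g₂ T) : IsPairBound g₂ g₁ T where
  measurable_left := h.measurable_right
  measurable_right := h.measurable_left
  left_ne_zero := h.right_ne_zero
  right_ne_zero := h.left_ne_zero
  left_ne_top := h.right_ne_top
  right_ne_top := h.left_ne_top
  le a l hl := by
    have := h.le a l hl
    simp only [mul_comm (g₂ _ ^ (1 / 2 : ℝ))]
    rwa [mul_right_comm]

lemma measurable_mul (h : IsPairBound g₁ g₂ T) :
    Measurable fun x => g₁ x ^ (1 / 2 : ℝ) * g₂ x ^ (1 / 2 : ℝ) :=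
  (h.measurable_left.pow_const _).mul (h.measurable_right.pow_const _)

lemma mul_ne_zero (h : IsPairBound g₁ g₂ T) :
    ∀ᵐ x, g₁ x ^ (1 / 2 : ℝ) * g₂ x ^ (1 / 2 : ℝ) ≠ 0 := by
  filter_upwards [h.left_ne_zero, h.right_ne_zero] with x h1 h2
  simp [h1, h2]

lemma mul_ne_top (h : IsPairBound g₁ g₂ T) :
    ∀ᵐ x, g₁ x ^ (1 / 2 : ℝ) * g₂ x ^ (1 / 2 : ℝ) ≠ ∞ := by
  filter_upwards [h.left_ne_top, h.right_ne_top] with x h1 h2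
  finiteness

lemma laverage_inv_ne_zero (h : IsPairBound g₁ g₂ T) (a : Fin n → ℝ) {l : ℝ} (hl : 0 < l) :
    (⨍⁻ x in halfOpenCube a l, (g₁ x)⁻¹ ∂volume) ≠ 0 := by
  refine setLAverage_halfOpenCube_ne_zero h.measurable_left.inv ?_ a hl
  filter_upwards [h.left_ne_top] with x hx
  simpa using hx

lemma laverage_mul_ne_zero (h : IsPairBound g₁ g₂ T) (a : Fin n → ℝ) {l : ℝ} (hl : 0 < l) :
    (⨍⁻ x in halfOpenCube a l, g₁ x ^ (1 / 2 : ℝ) * g₂ x ^ (1 / 2 : ℝ) ∂volume) ≠ 0 :=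
  setLAverage_halfOpenCube_ne_zero h.measurable_mul h.mul_ne_zero a hl

/-- A single weight need not be locally integrable. Finiteness here comes from the bound on the
triple product, whose other two factors are nonzero. -/
lemma laverage_mul_ne_top (h : IsPairBound g₁ g₂ T) (a : Fin n → ℝ) {l : ℝ} (hl : 0 < l) :
    (⨍⁻ x in halfOpenCube a l, g₁ x ^ (1 / 2 : ℝ) * g₂ x ^ (1 / 2 : ℝ) ∂volume) ≠ ∞ := by
  intro ht
  have := h.le a l hl
  rw [ht, ENNReal.top_mul (by simp [h.laverage_inv_ne_zero a hl]),
    ENNReal.top_mul (by simp [h.symm.laverage_inv_ne_zero a hl])] at this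
  simp at this

lemma laverage_inv_ne_top (h : IsPairBound g₁ g₂ T) (a : Fin n → ℝ) {l : ℝ} (hl : 0 < l) :
    (⨍⁻ x in halfOpenCube a l, (g₁ x)⁻¹ ∂volume) ≠ ∞ := by
  intro ht
  have := h.le a l hl
  rw [ht, ENNReal.top_rpow_of_pos (by norm_num), ENNReal.mul_top (h.laverage_mul_ne_zero a hl),
    ENNReal.top_mul (by simp [h.symm.laverage_inv_ne_zero a hl])] at this
  simp at this

lemma laverage_mul_mul_laverage_inv_le (h : IsPairBound g₁ g₂ T) (a : Fin n → ℝ) {l : ℝ}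
    (hl : 0 < l) :
    (⨍⁻ x in halfOpenCube a l, g₁ x ^ (1 / 2 : ℝ) * g₂ x ^ (1 / 2 : ℝ) ∂volume) *
      (⨍⁻ x in halfOpenCube a l, (g₁ x ^ (1 / 2 : ℝ) * g₂ x ^ (1 / 2 : ℝ))⁻¹ ∂volume) ≤
        ENNReal.ofReal T := by
  refine le_trans ?_ (h.le a l hl)
  rw [mul_assoc]
  gcongr
  refine le_trans (le_of_eq ?_) (laverage_mul_rpow_le h.measurable_left.inv h.measurable_right.inv
    (by norm_num) (by norm_num) (by norm_num))
  refine setLAverage_congr_ae _ ?_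
  filter_upwards [h.left_ne_zero, h.left_ne_top] with x h0 ht
  rw [ENNReal.mul_inv (Or.inl (by simp [h0])) (Or.inl (by finiteness)), Pi.inv_apply, Pi.inv_apply,
    ENNReal.inv_rpow, ENNReal.inv_rpow]

lemma one_le (h : IsPairBound g₁ g₂ T) : 1 ≤ T := by
  have := (one_le_laverage_mul_laverage_inv h.measurable_mul h.mul_ne_zero h.mul_ne_top
    0 one_pos).trans (h.laverage_mul_mul_laverage_inv_le 0 one_pos)
  simpa using this

lemma isHalfBounded_mul (h : IsPairBound g₁ g₂ T) :
    IsHalfBounded (fun x => g₁ x ^ (1 / 2 : ℝ) * g₂ x ^ (1 / 2 : ℝ)) (2 * T) := by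
  refine isHalfBounded_of_laverage_mul_le h.measurable_mul (q := 1) (A := T) one_pos
    (by linarith [h.one_le]) ?_ (fun a l hl => h.laverage_mul_ne_top a hl) fun a l hl => ?_
  · rw [ENNReal.rpow_one, ENNReal.rpow_one, ENNReal.ofReal_mul (by norm_num), ENNReal.ofReal_ofNat]
  · simpa only [ENNReal.rpow_one] using h.laverage_mul_mul_laverage_inv_le a hl

/-- The `A_4` condition for `g₁⁻¹`: with `v = g₁^(1/2) g₂^(1/2)` one has `g₁^(1/3) = v^(2/3)
g₂^(-1/3)`, and Hölder bounds its mean. The 8 is there because `8 ^ (1/3) = 2`. -/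
lemma isHalfBounded_inv (h : IsPairBound g₁ g₂ T) :
    IsHalfBounded (fun x => (g₁ x)⁻¹) (8 * T ^ 2) := by
  have hT := h.one_le
  refine isHalfBounded_of_laverage_mul_le h.measurable_left.inv (q := 1 / 3) (A := T ^ 2)
    (by norm_num) (by positivity) ?_ (fun a l hl => h.laverage_inv_ne_top a hl) fun a l hl => ?_
  · rw [ENNReal.ofReal_mul (by norm_num), ENNReal.mul_rpow_of_nonneg _ _ (by norm_num)]
    gcongr
    rw [ENNReal.ofReal_rpow_of_nonneg (by norm_num) (by norm_num),
      show (8 : ℝ) = 2 ^ (3 : ℝ) by norm_num, ← Real.rpow_mul (by norm_num)]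
    norm_num
  · have hae : (⨍⁻ x in halfOpenCube a l, ((g₁ x)⁻¹ ^ (1 / 3 : ℝ))⁻¹ ∂volume) ≤
        (⨍⁻ x in halfOpenCube a l, g₁ x ^ (1 / 2 : ℝ) * g₂ x ^ (1 / 2 : ℝ) ∂volume) ^ (2 / 3 : ℝ) *
          (⨍⁻ x in halfOpenCube a l, (g₂ x)⁻¹ ∂volume) ^ (1 / 3 : ℝ) := by
      refine le_trans (le_of_eq ?_) (laverage_mul_rpow_le h.measurable_mul h.measurable_right.inv
        (by norm_num) (by norm_num) (by norm_num))
      refine setLAverage_congr_ae _ ?_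
      filter_upwards [h.right_ne_zero, h.right_ne_top] with x h0 ht
      rw [ENNReal.mul_rpow_of_nonneg _ _ (by norm_num), ← ENNReal.rpow_mul, ← ENNReal.rpow_mul,
        Pi.inv_apply, ENNReal.inv_rpow, ENNReal.inv_rpow, inv_inv, mul_assoc,
        show (1 / 2 * (2 / 3) : ℝ) = 1 / 3 by norm_num,
        ENNReal.mul_inv_cancel (by simp [h0]) (by finiteness), mul_one]
    refine (mul_le_mul_right hae _).trans ?_
    have h1 := ENNReal.rpow_le_rpow (h.le a l hl) (by norm_num : (0 : ℝ) ≤ 2 / 3)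
    rw [ENNReal.mul_rpow_of_nonneg _ _ (by norm_num), ENNReal.mul_rpow_of_nonneg _ _ (by norm_num),
      ← ENNReal.rpow_mul, ← ENNReal.rpow_mul, show (1 / 2 * (2 / 3) : ℝ) = 1 / 3 by norm_num] at h1
    calc _ = _ := by simp only [Pi.inv_apply]; ring
      _ ≤ _ := h1
      _ = ENNReal.ofReal (T ^ 2) ^ (1 / 3 : ℝ) := by
        rw [ENNReal.ofReal_pow (by linarith), ← ENNReal.rpow_natCast, ← ENNReal.rpow_mul]
        norm_num

end IsPairBound

/-- Since `log y ≤ y - 1`, the power `(8 * T ^ 2) ^ r` is at most `e ≤ 3`. The constant is `96 = 8 *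
12`, so that `2 * 3 / 12 = 1 / 2`. -/
lemma exponent_mul_rpow_le {n : ℕ} {T r : ℝ} (hT : 1 ≤ T) (hr : 0 < r)
    (hrT : r ≤ 1 / (96 * 2 ^ n) * T ^ (-2 : ℤ)) :
    r * 2 ^ (n + 1) * (8 * T ^ 2) ^ (1 + r) ≤ 1 / 2 := by
  have hT0 : 0 < T := by linarith
  have h2 : (1 : ℝ) ≤ 2 ^ n := one_le_pow₀ (by norm_num)
  have hkey : r * (8 * T ^ 2) ≤ 1 / (12 * 2 ^ n) := by
    calc r * (8 * T ^ 2) ≤ 1 / (96 * 2 ^ n) * T ^ (-2 : ℤ) * (8 * T ^ 2) := by gcongr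
      _ = 1 / (12 * 2 ^ n) := by
        rw [zpow_neg, zpow_ofNat]
        field_simp
        norm_num
  have hle1 : r * (8 * T ^ 2) ≤ 1 := by
    refine hkey.trans ?_
    rw [div_le_one (by positivity)]
    linarith
  have hexp : (8 * T ^ 2) ^ r ≤ 3 := by
    rw [Real.rpow_def_of_pos (by positivity)]
    calc Real.exp (Real.log (8 * T ^ 2) * r) ≤ Real.exp 1 := by
          rw [Real.exp_le_exp]
          have := Real.log_le_sub_one_of_pos (show 0 < 8 * T ^ 2 by positivity)
          nlinarith
      _ ≤ 3 := by linarith [Real.exp_one_lt_d9]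
  rw [Real.rpow_add (by positivity), Real.rpow_one, pow_succ]
  calc r * (2 ^ n * 2) * (8 * T ^ 2 * (8 * T ^ 2) ^ r)
      = r * (8 * T ^ 2) * (2 ^ n * 2) * (8 * T ^ 2) ^ r := by ring
    _ ≤ 1 / (12 * 2 ^ n) * (2 ^ n * 2) * 3 := by gcongr
    _ = 1 / 2 := by field_simp; norm_num

/-- Three reverse Hölder inequalities, each with factor 2; the exponents 1, 1/2, 1/2 give the 4. -/
lemma IsPairBound.laverage_rpow_le {g₁ g₂ : (Fin n → ℝ) → ℝ≥0∞} {T r : ℝ}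
    (h : IsPairBound g₁ g₂ T) (hr : 0 < r) (hrT : r ≤ 1 / (96 * 2 ^ n) * T ^ (-2 : ℤ))
    (a : Fin n → ℝ) {l : ℝ} (hl : 0 < l) :
    (⨍⁻ x in halfOpenCube a l, (g₁ x ^ (1 / 2 : ℝ) * g₂ x ^ (1 / 2 : ℝ)) ^ (1 + r) ∂volume) *
      (⨍⁻ x in halfOpenCube a l, (g₁ x)⁻¹ ^ (1 + r) ∂volume) ^ (1 / 2 : ℝ) *
      (⨍⁻ x in halfOpenCube a l, (g₂ x)⁻¹ ^ (1 + r) ∂volume) ^ (1 / 2 : ℝ) ≤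
        4 * ENNReal.ofReal T ^ (1 + r) := by
  have hT := h.one_le
  have hr1 : 0 ≤ 1 + r := by linarith
  have hσ := exponent_mul_rpow_le (n := n) hT hr hrT
  have hv : r * 2 ^ (n + 1) * (2 * T) ^ (1 + r) ≤ 1 / 2 := by
    refine le_trans ?_ hσ
    gcongr
    all_goals nlinarith
  have e1 := h.isHalfBounded_mul.laverage_rpow_le (by linarith) a hl hr hv
  have e2 := h.isHalfBounded_inv.laverage_rpow_le (by nlinarith) a hl hr hσ
  have e3 := h.symm.isHalfBounded_inv.laverage_rpow_le (by nlinarith) a hl hr hσ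
  have hcomm : ∀ y : ℝ≥0∞, (y ^ (1 + r)) ^ (1 / 2 : ℝ) = (y ^ (1 / 2 : ℝ)) ^ (1 + r) := fun y => by
    rw [← ENNReal.rpow_mul, ← ENNReal.rpow_mul, mul_comm]
  have hsq : (2 : ℝ≥0∞) ^ (1 / 2 : ℝ) * 2 ^ (1 / 2 : ℝ) = 2 := by
    rw [← ENNReal.rpow_add _ _ (by norm_num) (by norm_num)]
    norm_num
  calc _ ≤ 2 * (⨍⁻ x in halfOpenCube a l, g₁ x ^ (1 / 2 : ℝ) * g₂ x ^ (1 / 2 : ℝ) ∂volume) ^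
          (1 + r) *
        (2 * (⨍⁻ x in halfOpenCube a l, (g₁ x)⁻¹ ∂volume) ^ (1 + r)) ^ (1 / 2 : ℝ) *
        (2 * (⨍⁻ x in halfOpenCube a l, (g₂ x)⁻¹ ∂volume) ^ (1 + r)) ^ (1 / 2 : ℝ) := by gcongr
    _ = 2 * (2 ^ (1 / 2 : ℝ) * 2 ^ (1 / 2 : ℝ)) *
        ((⨍⁻ x in halfOpenCube a l, g₁ x ^ (1 / 2 : ℝ) * g₂ x ^ (1 / 2 : ℝ) ∂volume) *
          (⨍⁻ x in halfOpenCube a l, (g₁ x)⁻¹ ∂volume) ^ (1 / 2 : ℝ) *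
          (⨍⁻ x in halfOpenCube a l, (g₂ x)⁻¹ ∂volume) ^ (1 / 2 : ℝ)) ^ (1 + r) := by
        rw [ENNReal.mul_rpow_of_nonneg _ _ (by norm_num : (0 : ℝ) ≤ 1 / 2),
          ENNReal.mul_rpow_of_nonneg _ _ (by norm_num : (0 : ℝ) ≤ 1 / 2),
          ENNReal.mul_rpow_of_nonneg _ _ hr1, ENNReal.mul_rpow_of_nonneg _ _ hr1, hcomm, hcomm]
        ring
    _ ≤ 2 * (2 ^ (1 / 2 : ℝ) * 2 ^ (1 / 2 : ℝ)) * ENNReal.ofReal T ^ (1 + r) := by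
        gcongr
        exact h.le a l hl
    _ = _ := by
        rw [hsq]
        norm_num

/-- Weights are only a.e. measurable, so measurable representatives are chosen. -/
lemma IsA22.exists_isPairBound {w₁ w₂ : (Fin n → ℝ) → ℝ} (h : IsA22 w₁ w₂) :
    ∃ g₁ g₂ : (Fin n → ℝ) → ℝ≥0∞, (fun x => ENNReal.ofReal (w₁ x)) =ᵐ[volume] g₁ ∧
      (fun x => ENNReal.ofReal (w₂ x)) =ᵐ[volume] g₂ ∧
      IsPairBound g₁ g₂ (a22Const w₁ w₂).toReal := by
  have m₁ := h.left.aemeasurable.ennreal_ofReal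
  have m₂ := h.right.aemeasurable.ennreal_ofReal
  have e₁ := m₁.ae_eq_mk
  have e₂ := m₂.ae_eq_mk
  refine ⟨m₁.mk _, m₂.mk _, e₁, e₂, m₁.measurable_mk, m₂.measurable_mk, ?_, ?_, ?_, ?_, ?_⟩
  · filter_upwards [e₁, h.left.ae_pos] with x hx hpos
    rw [← hx]; simpa using hpos
  · filter_upwards [e₂, h.right.ae_pos] with x hx hpos
    rw [← hx]; simpa using hpos
  · filter_upwards [e₁] with x hx
    rw [← hx]; simp
  · filter_upwards [e₂] with x hx
    rw [← hx]; simp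
  · intro a l hl
    rw [ENNReal.ofReal_toReal h.const_lt_top.ne]
    refine le_trans (le_of_eq ?_) (le_iSup_of_le a (le_iSup₂_of_le l hl le_rfl))
    simp only [setLAverage_cube]
    congr 2
    · refine setLAverage_congr_ae _ ?_
      filter_upwards [e₁, e₂] with x h1 h2
      rw [h1, h2]
    · congr 1
      refine setLAverage_congr_ae _ ?_
      filter_upwards [e₁] with x h1
      rw [h1]
    · refine setLAverage_congr_ae _ ?_
      filter_upwards [e₂] with x h1
      rw [h1]

theorem IsA22.revHolder {w₁ w₂ : (Fin n → ℝ) → ℝ} (h : IsA22 w₁ w₂) {r : ℝ} (hr : 0 < r)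
    (hrT : r ≤ 1 / (96 * 2 ^ n) * (a22Const w₁ w₂).toReal ^ (-2 : ℤ)) :
    RevHolder 4 w₁ w₂ r := by
  obtain ⟨g₁, g₂, e₁, e₂, hg⟩ := h.exists_isPairBound
  have hr1 : 0 ≤ 1 + r := by linarith
  have hpow₁ : ∀ x, ENNReal.ofReal (w₁ x ^ (1 + r)) = ENNReal.ofReal (w₁ x) ^ (1 + r) := fun x =>
    (ENNReal.ofReal_rpow_of_nonneg (h.left.nonneg x) hr1).symm
  have hpow₂ : ∀ x, ENNReal.ofReal (w₂ x ^ (1 + r)) = ENNReal.ofReal (w₂ x) ^ (1 + r) := fun x =>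
    (ENNReal.ofReal_rpow_of_nonneg (h.right.nonneg x) hr1).symm
  have hcomm : ∀ y : ℝ≥0∞, (y ^ (1 + r)) ^ (1 / 2 : ℝ) = (y ^ (1 / 2 : ℝ)) ^ (1 + r) := fun y => by
    rw [← ENNReal.rpow_mul, ← ENNReal.rpow_mul, mul_comm]
  refine iSup_le fun a => iSup₂_le fun l hl => ?_
  have key := hg.laverage_rpow_le hr hrT a hl
  rw [ENNReal.ofReal_toReal h.const_lt_top.ne] at key
  refine le_trans (le_of_eq ?_) key
  simp only [setLAverage_cube, hpow₁, hpow₂]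
  congr 2
  · refine setLAverage_congr_ae _ ?_
    filter_upwards [e₁, e₂] with x h1 h2
    rw [h1, h2, hcomm, hcomm, ENNReal.mul_rpow_of_nonneg _ _ hr1]
  · congr 1
    refine setLAverage_congr_ae _ ?_
    filter_upwards [e₁] with x h1
    rw [h1, ENNReal.inv_rpow]
  · refine setLAverage_congr_ae _ ?_
    filter_upwards [e₂] with x h1
    rw [h1, ENNReal.inv_rpow]

/-! ### The necessary condition: power weights in one coordinate -/

lemma setLIntegral_Icc_abs_rpow {p M : ℝ} (hp : -1 < p) (hM : 0 ≤ M) :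
    ∫⁻ y in Set.Icc 0 M, ENNReal.ofReal |y| ^ p = ENNReal.ofReal (M ^ (p + 1) / (p + 1)) := by
  have hint := (intervalIntegrable_iff_integrableOn_Ioc_of_le hM).1
    (intervalIntegral.intervalIntegrable_rpow' (a := 0) (b := M) hp)
  have hval : ∫ y in Set.Ioc 0 M, y ^ p = M ^ (p + 1) / (p + 1) := by
    rw [← intervalIntegral.integral_of_le hM, integral_rpow (Or.inl hp),
      Real.zero_rpow (by linarith), sub_zero]
  rw [setLIntegral_congr Ioc_ae_eq_Icc.symm, ← hval, ofReal_integral_eq_lintegral_ofReal hint]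
  · refine setLIntegral_congr_fun measurableSet_Ioc fun y hy => ?_
    rw [abs_of_pos hy.1, ENNReal.ofReal_rpow_of_pos hy.1]
  · filter_upwards [ae_restrict_mem measurableSet_Ioc] with y hy
    exact Real.rpow_nonneg hy.1.le _

lemma setLIntegral_Icc_neg_abs_rpow_le {p M : ℝ} (hp : -1 < p) (hM : 0 ≤ M) :
    ∫⁻ y in Set.Icc (-M) M, ENNReal.ofReal |y| ^ p ≤
      2 * ENNReal.ofReal (M ^ (p + 1) / (p + 1)) := by
  have hneg : ∫⁻ y in Set.Icc (-M) 0, ENNReal.ofReal |y| ^ p =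
      ∫⁻ y in Set.Icc 0 M, ENNReal.ofReal |y| ^ p := by
    rw [← (Measure.measurePreserving_neg (volume : Measure ℝ)).setLIntegral_comp_preimage
      measurableSet_Icc (by fun_prop)]
    simp
  rw [← Set.Icc_union_Icc_eq_Icc (neg_nonpos.2 hM) hM]
  refine (lintegral_union_le _ _ _).trans_eq ?_
  rw [hneg, setLIntegral_Icc_abs_rpow hp hM, two_mul]

/-- The image of Lebesgue measure on the cube under a coordinate is a multiple of Lebesgue measure
on its side. -/
lemma setLAverage_cube_comp_eval {g : ℝ → ℝ≥0∞} (hg : Measurable g) (i : Fin n) (a : Fin n → ℝ)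
    {l : ℝ} (hl : 0 < l) :
    (⨍⁻ x in cube a l, g (x i) ∂volume) =
      (∫⁻ y in Set.Icc (a i) (a i + l), g y) / ENNReal.ofReal l := by
  have hl0 : ENNReal.ofReal l ≠ 0 := by simpa using hl
  rw [setLAverage_eq, volume_cube]
  have hmap : Measure.map (Function.eval i) (volume.restrict (cube a l)) =
      ENNReal.ofReal l ^ (n - 1) • volume.restrict (Set.Icc (a i) (a i + l)) := by
    rw [cube, ← Set.pi_univ_Icc, volume_pi, Measure.restrict_pi_pi, Measure.pi_map_eval]
    simp
  have hint : ∫⁻ x in cube a l, g (x i) =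
      ENNReal.ofReal l ^ (n - 1) * ∫⁻ y in Set.Icc (a i) (a i + l), g y := by
    rw [← smul_eq_mul, ← lintegral_smul_measure, ← hmap, lintegral_map hg (measurable_pi_apply i)]
  have hn : n = (n - 1) + 1 := by have := i.pos; omega
  rw [hint]
  conv_lhs => rw [show ENNReal.ofReal l ^ n = ENNReal.ofReal l ^ (n - 1) * ENNReal.ofReal l by
    rw [← pow_succ, ← hn]]
  exact ENNReal.mul_div_mul_left _ _ (by simp [hl0]) (by finiteness)

/-- The weight `|x i| ^ s`. -/
noncomputable def coordPow (i : Fin n) (s : ℝ) (x : Fin n → ℝ) : ℝ := |x i| ^ s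

lemma a22Const_coordPow (i : Fin n) {s : ℝ} (hs : 0 ≤ s) :
    a22Const (coordPow i s) (fun _ => 1) = ⨆ (a : Fin n → ℝ) (l : ℝ) (_ : 0 < l),
      (⨍⁻ x in cube a l, ENNReal.ofReal |x i| ^ (s / 2) ∂volume) *
        (⨍⁻ x in cube a l, (ENNReal.ofReal |x i|)⁻¹ ^ s ∂volume) ^ (1 / 2 : ℝ) := by
  refine iSup_congr fun a => iSup_congr fun l => iSup_congr fun hl => ?_
  have h1 : (⨍⁻ _ in cube a l, (ENNReal.ofReal 1)⁻¹ ∂volume) = 1 := by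
    rw [ENNReal.ofReal_one, inv_one, setLAverage_const]
    · rw [volume_cube]; exact pow_ne_zero _ (by simpa using hl)
    · rw [volume_cube]; finiteness
  rw [h1, ENNReal.one_rpow, mul_one]
  simp only [coordPow, ← ENNReal.ofReal_rpow_of_nonneg (abs_nonneg _) hs, ENNReal.ofReal_one,
    ENNReal.one_rpow, mul_one, ← ENNReal.rpow_mul, ENNReal.inv_rpow, mul_one_div]

/-- Log-convexity in the exponent: Hölder in each of the two averages. -/
lemma a22Const_coordPow_le_mul (i : Fin n) {s t p q : ℝ} (hs : 0 ≤ s) (ht : 0 ≤ t) (hp : 0 ≤ p)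
    (hq : 0 ≤ q) (hpq : p + q = 1) :
    a22Const (coordPow i (p * s + q * t)) (fun _ => 1) ≤
      a22Const (coordPow i s) (fun _ => 1) ^ p * a22Const (coordPow i t) (fun _ => 1) ^ q := by
  rw [a22Const_coordPow i (by positivity)]
  refine iSup_le fun a => iSup₂_le fun l hl => ?_
  have hsup : ∀ u : ℝ, 0 ≤ u → (⨍⁻ x in cube a l, ENNReal.ofReal |x i| ^ (u / 2) ∂volume) *
      (⨍⁻ x in cube a l, (ENNReal.ofReal |x i|)⁻¹ ^ u ∂volume) ^ (1 / 2 : ℝ) ≤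
      a22Const (coordPow i u) (fun _ => 1) := fun u hu => by
    rw [a22Const_coordPow i hu]
    exact le_iSup_of_le a (le_iSup₂_of_le l hl le_rfl)
  have hsplit : ∀ (y : ℝ≥0∞) (u v : ℝ), 0 ≤ u → 0 ≤ v →
      y ^ (p * u + q * v) = (y ^ u) ^ p * (y ^ v) ^ q := fun y u v hu hv => by
    rw [ENNReal.rpow_add_of_nonneg _ _ (by positivity) (by positivity), mul_comm p, mul_comm q,
      ENNReal.rpow_mul, ENNReal.rpow_mul]
  have hcomm : ∀ (y : ℝ≥0∞) (u : ℝ), (y ^ u) ^ (1 / 2 : ℝ) = (y ^ (1 / 2 : ℝ)) ^ u :=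
    fun y u => by rw [← ENNReal.rpow_mul, ← ENNReal.rpow_mul, mul_comm]
  refine le_trans ?_ (mul_le_mul' (ENNReal.rpow_le_rpow (hsup s hs) hp)
    (ENNReal.rpow_le_rpow (hsup t ht) hq))
  rw [show (p * s + q * t) / 2 = p * (s / 2) + q * (t / 2) by ring]
  simp only [hsplit _ _ _ hs ht, hsplit _ (s / 2) (t / 2) (by positivity) (by positivity)]
  have m1 : ∀ u : ℝ, Measurable fun x : Fin n → ℝ => ENNReal.ofReal |x i| ^ u := fun u => by
    fun_prop
  have m2 : ∀ u : ℝ, Measurable fun x : Fin n → ℝ => (ENNReal.ofReal |x i|)⁻¹ ^ u := fun u => by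
    fun_prop
  refine (mul_le_mul' (laverage_mul_rpow_le (m1 _) (m1 _) hp hq hpq)
    (ENNReal.rpow_le_rpow (laverage_mul_rpow_le (m2 _) (m2 _) hp hq hpq)
      (by norm_num : (0 : ℝ) ≤ 1 / 2))).trans_eq ?_
  rw [ENNReal.mul_rpow_of_nonneg _ _ (by norm_num : (0 : ℝ) ≤ 1 / 2),
    ENNReal.mul_rpow_of_nonneg _ _ hp, ENNReal.mul_rpow_of_nonneg _ _ hq, hcomm, hcomm]
  ring

lemma setLAverage_coord_rpow_le (i : Fin n) {s : ℝ} (hs : 0 ≤ s) (hs1 : s < 1) (a : Fin n → ℝ)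
    {l : ℝ} (hl : 0 < l) {M : ℝ} (hM : M = max |a i| |a i + l|) (hM0 : 0 < M) :
    (⨍⁻ x in cube a l, (ENNReal.ofReal |x i|)⁻¹ ^ s ∂volume) ≤
      ENNReal.ofReal (4 * M ^ (-s) / (1 - s)) := by
  have h1s : 0 < 1 - s := by linarith
  rw [setLAverage_cube_comp_eval (g := fun y => (ENNReal.ofReal |y|)⁻¹ ^ s) (by fun_prop) i a hl]
  refine ENNReal.div_le_of_le_mul ?_
  rw [← ENNReal.ofReal_mul (by positivity)]
  simp only [ENNReal.inv_rpow, ← ENNReal.rpow_neg]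
  -- Either the side is comparable to `M` and may be enlarged to `[-M, M]`, or the cube is far from
  -- the hyperplane and `|y| ≥ M / 2` on it.
  rcases le_or_gt M (2 * l) with hcase | hcase
  · calc _ ≤ ∫⁻ y in Set.Icc (-M) M, ENNReal.ofReal |y| ^ (-s) := by
          refine lintegral_mono_set (Set.Icc_subset_Icc ?_ ?_)
          · exact (neg_le_neg (hM ▸ le_max_left _ _)).trans (neg_abs_le _)
          · exact (le_abs_self _).trans (hM ▸ le_max_right _ _)
      _ ≤ 2 * ENNReal.ofReal (M ^ (-s + 1) / (-s + 1)) :=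
          setLIntegral_Icc_neg_abs_rpow_le (by linarith) hM0.le
      _ = ENNReal.ofReal (2 * (M ^ (-s + 1) / (-s + 1))) := by
          rw [ENNReal.ofReal_mul (by norm_num), ENNReal.ofReal_ofNat]
      _ ≤ _ := by
          refine ENNReal.ofReal_le_ofReal ?_
          rw [Real.rpow_add hM0, Real.rpow_one, show -s + 1 = 1 - s by ring]
          calc 2 * (M ^ (-s) * M / (1 - s)) = 2 * M ^ (-s) / (1 - s) * M := by ring
            _ ≤ 2 * M ^ (-s) / (1 - s) * (2 * l) := by gcongr
            _ = _ := by ring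
  · calc _ ≤ ∫⁻ _ in Set.Icc (a i) (a i + l), ENNReal.ofReal ((M / 2) ^ (-s)) := by
          refine setLIntegral_mono' measurableSet_Icc fun y hy => ?_
          have hy2 : M / 2 ≤ |y| := by
            rcases max_cases |a i| |a i + l| with ⟨h, _⟩ | ⟨h, _⟩
            · have := abs_sub_abs_le_abs_sub (a i) y
              have h' : |a i - y| ≤ l := abs_le.2 ⟨by linarith [hy.2], by linarith [hy.1]⟩
              linarith
            · have := abs_sub_abs_le_abs_sub (a i + l) y
              have h' : |a i + l - y| ≤ l := abs_le.2 ⟨by linarith [hy.2], by linarith [hy.1]⟩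
              linarith
          rw [ENNReal.ofReal_rpow_of_pos (by linarith)]
          exact ENNReal.ofReal_le_ofReal
            (Real.rpow_le_rpow_of_nonpos (by positivity) hy2 (by linarith))
      _ = ENNReal.ofReal ((M / 2) ^ (-s) * l) := by
          rw [setLIntegral_const, Real.volume_Icc, add_sub_cancel_left,
            ENNReal.ofReal_mul (by positivity)]
      _ ≤ _ := by
          refine ENNReal.ofReal_le_ofReal ?_
          gcongr
          rw [Real.div_rpow hM0.le (by norm_num), le_div_iff₀ h1s, Real.rpow_neg zero_le_two,
            div_inv_eq_mul]
          have h2 : (2 : ℝ) ^ s ≤ 2 := by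
            simpa using Real.rpow_le_rpow_of_exponent_le (x := 2) (by norm_num) hs1.le
          have hMs : 0 < M ^ (-s) := by positivity
          have h22 : (2 : ℝ) ^ s * (1 - s) ≤ 4 := by nlinarith
          calc M ^ (-s) * 2 ^ s * (1 - s) = M ^ (-s) * (2 ^ s * (1 - s)) := by ring
            _ ≤ M ^ (-s) * 4 := by gcongr
            _ = _ := by ring

/-- With `M` the largest `|x i|` on the cube, the factors `M ^ (s / 2)` and `(M ^ (-s)) ^ (1 / 2)`
cancel. -/
lemma a22Const_coordPow_le (i : Fin n) {s : ℝ} (hs : 0 ≤ s) (hs1 : s < 1) :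
    a22Const (coordPow i s) (fun _ => 1) ≤ ENNReal.ofReal (2 * (1 - s) ^ (-(1 / 2) : ℝ)) := by
  have h1s : 0 < 1 - s := by linarith
  rw [a22Const_coordPow i hs]
  refine iSup_le fun a => iSup₂_le fun l hl => ?_
  set M := max |a i| |a i + l| with hM
  have hM0 : 0 < M := by
    rcases eq_or_ne (a i) 0 with h | h
    · exact lt_max_of_lt_right (by rw [h, zero_add]; exact abs_pos.2 hl.ne')
    · exact lt_max_of_lt_left (abs_pos.2 h)
  have h1 : (⨍⁻ x in cube a l, ENNReal.ofReal |x i| ^ (s / 2) ∂volume) ≤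
      ENNReal.ofReal (M ^ (s / 2)) := by
    rw [setLAverage_cube_comp_eval (g := fun y => ENNReal.ofReal |y| ^ (s / 2)) (by fun_prop) i a hl]
    refine ENNReal.div_le_of_le_mul ?_
    calc _ ≤ ∫⁻ _ in Set.Icc (a i) (a i + l), ENNReal.ofReal (M ^ (s / 2)) := by
          refine setLIntegral_mono' measurableSet_Icc fun y hy => ?_
          rw [← ENNReal.ofReal_rpow_of_pos hM0]
          gcongr
          exact abs_le_max_abs_abs hy.1 hy.2
      _ = _ := by rw [setLIntegral_const, Real.volume_Icc, add_sub_cancel_left]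
  calc _ ≤ ENNReal.ofReal (M ^ (s / 2)) *
        ENNReal.ofReal (4 * M ^ (-s) / (1 - s)) ^ (1 / 2 : ℝ) := by
        gcongr
        exact setLAverage_coord_rpow_le i hs hs1 a hl hM hM0
    _ = ENNReal.ofReal (M ^ (s / 2) * (4 * M ^ (-s) / (1 - s)) ^ (1 / 2 : ℝ)) := by
        rw [ENNReal.ofReal_rpow_of_nonneg (by positivity) (by norm_num),
          ENNReal.ofReal_mul (by positivity)]
    _ = _ := by
        congr 1
        have h4 : (4 : ℝ) ^ (1 / 2 : ℝ) = 2 := by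
          rw [show (4 : ℝ) = 2 ^ (2 : ℝ) by norm_num, ← Real.rpow_mul (by norm_num)]
          norm_num
        rw [div_eq_mul_inv (4 * M ^ (-s)), Real.mul_rpow (by positivity) (by positivity),
          Real.mul_rpow (by norm_num) (by positivity), h4, ← Real.rpow_mul hM0.le,
          Real.inv_rpow h1s.le, ← Real.rpow_neg h1s.le]
        calc M ^ (s / 2) * (2 * M ^ (-s * (1 / 2)) * (1 - s) ^ (-(1 / 2) : ℝ))
            = 2 * (M ^ (s / 2) * M ^ (-s * (1 / 2))) * (1 - s) ^ (-(1 / 2) : ℝ) := by ring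
          _ = _ := by
            rw [← Real.rpow_add hM0, show s / 2 + -s * (1 / 2) = 0 by ring, Real.rpow_zero,
              mul_one]

lemma setLAverage_unit_coord_rpow (i : Fin n) {p : ℝ} (hp : -1 < p) :
    (⨍⁻ x in cube (0 : Fin n → ℝ) 1, ENNReal.ofReal |x i| ^ p ∂volume) =
      ENNReal.ofReal (1 / (p + 1)) := by
  rw [setLAverage_cube_comp_eval (g := fun y => ENNReal.ofReal |y| ^ p) (by fun_prop) i 0 one_pos]
  simp only [Pi.zero_apply, zero_add, ENNReal.ofReal_one, div_one]
  rw [setLIntegral_Icc_abs_rpow hp zero_le_one, Real.one_rpow]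

lemma le_a22Const_coordPow (i : Fin n) {s : ℝ} (hs : 0 ≤ s) (hs1 : s < 1) :
    ENNReal.ofReal (1 / 2 * (1 / (1 - s)) ^ (1 / 2 : ℝ)) ≤
      a22Const (coordPow i s) (fun _ => 1) := by
  have h1s : 0 < 1 - s := by linarith
  rw [a22Const_coordPow i hs]
  refine le_iSup_of_le 0 (le_iSup₂_of_le 1 one_pos ?_)
  simp only [ENNReal.inv_rpow, ← ENNReal.rpow_neg]
  rw [setLAverage_unit_coord_rpow i (by linarith), setLAverage_unit_coord_rpow i (by linarith),
    ENNReal.ofReal_rpow_of_nonneg (by rw [neg_add_eq_sub]; positivity) (by norm_num),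
    ← ENNReal.ofReal_mul (by positivity), neg_add_eq_sub]
  refine ENNReal.ofReal_le_ofReal ?_
  gcongr
  linarith

/-- On the unit cube `|x i| ^ (-s)` dominates `|x i| ^ (-(1 - ε))`, whose mean is `1 / ε`; take `ε =
1 / (R + 1)`. -/
lemma a22Const_coordPow_eq_top (i : Fin n) {s : ℝ} (hs : 1 ≤ s) :
    a22Const (coordPow i s) (fun _ => 1) = ∞ := by
  rw [a22Const_coordPow i (by linarith), eq_top_iff]
  refine le_iSup_of_le 0 (le_iSup₂_of_le 1 one_pos ?_)
  have htop : (⨍⁻ x in cube (0 : Fin n → ℝ) 1, (ENNReal.ofReal |x i|)⁻¹ ^ s ∂volume) = ∞ := by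
    refine ENNReal.eq_top_of_forall_nnreal_le fun R => ?_
    have hR : (0 : ℝ) < R + 1 := by positivity
    have hlt : 1 / ((R : ℝ) + 1) ≤ 1 := by rw [div_le_one hR]; simp
    have hpos : 0 < 1 / ((R : ℝ) + 1) := by positivity
    have h := setLAverage_unit_coord_rpow i (p := -(1 - 1 / ((R : ℝ) + 1))) (by linarith)
    calc (R : ℝ≥0∞) ≤ ENNReal.ofReal (1 / (-(1 - 1 / ((R : ℝ) + 1)) + 1)) := by
          rw [show 1 / (-(1 - 1 / ((R : ℝ) + 1)) + 1) = R + 1 by field_simp; ring,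
            ← ENNReal.ofReal_coe_nnreal]
          exact ENNReal.ofReal_le_ofReal (by linarith)
      _ = _ := h.symm
      _ ≤ _ := by
          rw [setLAverage_eq, setLAverage_eq]
          refine ENNReal.div_le_div_right (setLIntegral_mono' measurableSet_Icc fun x hx => ?_) _
          rw [ENNReal.rpow_neg, ← ENNReal.inv_rpow]
          refine ENNReal.rpow_le_rpow_of_exponent_le ?_ (by linarith)
          rw [ENNReal.one_le_inv, ENNReal.ofReal_le_one, abs_le]
          have h0 := hx.1 i
          have h1 := hx.2 i
          simp only [Pi.zero_apply, zero_add] at h0 h1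
          constructor <;> linarith
  rw [htop, ENNReal.top_rpow_of_pos (by norm_num), setLAverage_unit_coord_rpow i (by linarith),
    ENNReal.mul_top]
  simp only [ne_eq, ENNReal.ofReal_eq_zero, not_le]
  positivity

lemma isA22_coordPow (i : Fin n) {s : ℝ} (hs : 0 ≤ s) (hs1 : s < 1) :
    IsA22 (coordPow i s) (fun _ => 1) where
  left :=
    { aemeasurable := ((measurable_pi_apply i).abs.pow_const s).aemeasurable
      nonneg := fun x => Real.rpow_nonneg (abs_nonneg _) _
      ae_pos := by
        have h : volume {x : Fin n → ℝ | x i = 0} = 0 := Measure.pi_hyperplane _ i 0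
        filter_upwards [measure_eq_zero_iff_ae_notMem.1 h] with x hx
        exact Real.rpow_pos_of_pos (abs_pos.2 hx) _ }
  right := ⟨aemeasurable_const, fun _ => zero_le_one, Eventually.of_forall fun _ => one_pos⟩
  const_lt_top := (a22Const_coordPow_le i hs hs1).trans_lt ENNReal.ofReal_lt_top

lemma IsA22.one_le_toReal {w₁ w₂ : (Fin n → ℝ) → ℝ} (h : IsA22 w₁ w₂) :
    1 ≤ (a22Const w₁ w₂).toReal := by
  obtain ⟨g₁, g₂, -, -, hg⟩ := h.exists_isPairBound
  exact hg.one_le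

/-! ### Attaining every value of the constant from `t₀` on -/

lemma toReal_a22Const_coordPow_le_mul (i : Fin n) {s t p q : ℝ} (hs : 0 ≤ s) (hs1 : s < 1)
    (ht : 0 ≤ t) (ht1 : t < 1) (hp : 0 ≤ p) (hq : 0 ≤ q) (hpq : p + q = 1) :
    (a22Const (coordPow i (p * s + q * t)) (fun _ => 1)).toReal ≤
      (a22Const (coordPow i s) (fun _ => 1)).toReal ^ p *
        (a22Const (coordPow i t) (fun _ => 1)).toReal ^ q := by
  have hs' := (isA22_coordPow i hs hs1).const_lt_top.ne
  have ht' := (isA22_coordPow i ht ht1).const_lt_top.ne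
  rw [ENNReal.toReal_rpow, ENNReal.toReal_rpow, ← ENNReal.toReal_mul]
  exact ENNReal.toReal_mono (by finiteness) (a22Const_coordPow_le_mul i hs ht hp hq hpq)

/-- A convex function on an open interval is continuous; apply this to the logarithm. -/
lemma continuousOn_toReal_a22Const_coordPow (i : Fin n) :
    ContinuousOn (fun s => (a22Const (coordPow i s) (fun _ => 1)).toReal) (Set.Ioo 0 1) := by
  have hpos : ∀ s ∈ Set.Ioo (0 : ℝ) 1, 0 < (a22Const (coordPow i s) (fun _ => 1)).toReal :=
    fun s hs => one_pos.trans_le (isA22_coordPow i hs.1.le hs.2).one_le_toReal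
  have hconv : ConvexOn ℝ (Set.Ioo 0 1)
      (fun s => Real.log (a22Const (coordPow i s) (fun _ => 1)).toReal) := by
    refine ⟨convex_Ioo 0 1, fun s hs t ht p q hp hq hpq => ?_⟩
    have hmem := (convex_Ioo (0 : ℝ) 1) hs ht hp hq hpq
    simp only [smul_eq_mul] at hmem ⊢
    have h := Real.log_le_log (hpos _ hmem)
      (toReal_a22Const_coordPow_le_mul i hs.1.le hs.2 ht.1.le ht.2 hp hq hpq)
    rwa [Real.log_mul (Real.rpow_pos_of_pos (hpos s hs) _).ne'
      (Real.rpow_pos_of_pos (hpos t ht) _).ne', Real.log_rpow (hpos s hs),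
      Real.log_rpow (hpos t ht)] at h
  refine ((hconv.continuousOn isOpen_Ioo).rexp).congr fun s hs => ?_
  exact (Real.exp_log (hpos s hs)).symm

lemma exists_toReal_a22Const_coordPow_le (i : Fin n) {t₀ : ℝ} (ht₀ : 1 < t₀) :
    ∃ s, 0 < s ∧ s ≤ 1 / 2 ∧ (a22Const (coordPow i s) (fun _ => 1)).toReal ≤ t₀ := by
  set f := fun s => (a22Const (coordPow i s) (fun _ => 1)).toReal with hf
  have h0 : f 0 = 1 := by
    refine le_antisymm ?_ (isA22_coordPow i le_rfl one_pos).one_le_toReal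
    refine ENNReal.toReal_le_of_le_ofReal zero_le_one ?_
    rw [a22Const_coordPow i le_rfl, ENNReal.ofReal_one]
    refine iSup_le fun a => iSup₂_le fun l hl => ?_
    have h1 : (⨍⁻ _ in cube a l, (1 : ℝ≥0∞) ∂volume) = 1 := by
      rw [setLAverage_const]
      · rw [volume_cube]; exact pow_ne_zero _ (by simpa using hl)
      · rw [volume_cube]; finiteness
    simp [h1]
  have hh : 1 ≤ f (1 / 2) := (isA22_coordPow i (by norm_num) (by norm_num)).one_le_toReal
  have hL : 0 < Real.log (f (1 / 2)) + 1 := by linarith [Real.log_nonneg hh]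
  have hlt : 0 < Real.log t₀ := Real.log_pos ht₀
  -- Continuity is not known at 0; log-convexity between 0 and 1/2 gives `f (θ / 2) ≤ f (1 / 2) ^ θ`
  -- instead. The `+ 1` keeps the denominator positive.
  set θ := min 1 (Real.log t₀ / (Real.log (f (1 / 2)) + 1)) with hθ
  have hθ0 : 0 < θ := lt_min one_pos (by positivity)
  have hθ1 : θ ≤ 1 := min_le_left _ _
  refine ⟨θ * (1 / 2), by positivity, by linarith, ?_⟩
  have h := toReal_a22Const_coordPow_le_mul i (s := 0) (t := 1 / 2) (p := 1 - θ) (q := θ) le_rfl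
    one_pos (by norm_num) (by norm_num) (by linarith) hθ0.le (by ring)
  rw [mul_zero, zero_add] at h
  refine h.trans ?_
  change f 0 ^ (1 - θ) * f (1 / 2) ^ θ ≤ t₀
  rw [h0, Real.one_rpow, one_mul, Real.rpow_def_of_pos (by linarith), ← Real.le_log_iff_exp_le
    (by linarith)]
  have h2 : θ * (Real.log (f (1 / 2)) + 1) ≤ Real.log t₀ := by
    rw [← le_div_iff₀ hL]
    exact min_le_right _ _
  nlinarith

lemma exists_toReal_a22Const_coordPow_eq (i : Fin n) {s₀ t : ℝ} (hs₀ : 0 < s₀) (hs₀' : s₀ ≤ 1 / 2)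
    (ht1 : 1 < t) (ht : (a22Const (coordPow i s₀) (fun _ => 1)).toReal ≤ t) :
    ∃ s, s₀ ≤ s ∧ s < 1 ∧ (a22Const (coordPow i s) (fun _ => 1)).toReal = t := by
  have ht0 : 0 < t := by linarith
  -- Chosen so that the lower bound `1 / 2 * (1 / (1 - s₁)) ^ (1 / 2)` equals `t`.
  set s₁ := 1 - 1 / (2 * t) ^ 2 with hs₁
  have hpos : 0 < 1 / (2 * t) ^ 2 := by positivity
  have hle : 1 / (2 * t) ^ 2 ≤ 1 / 2 := by
    apply one_div_le_one_div_of_le (by norm_num)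
    nlinarith
  have hs₁0 : 0 ≤ s₁ := by linarith
  have hs₁1 : s₁ < 1 := by linarith
  have hbig : t ≤ (a22Const (coordPow i s₁) (fun _ => 1)).toReal := by
    have h := le_a22Const_coordPow i hs₁0 hs₁1
    rw [ENNReal.ofReal_le_iff_le_toReal (isA22_coordPow i hs₁0 hs₁1).const_lt_top.ne] at h
    refine le_trans (le_of_eq ?_) h
    rw [hs₁, sub_sub_cancel, one_div_one_div, ← Real.sqrt_eq_rpow, Real.sqrt_sq (by positivity)]
    ring
  have hcont := (continuousOn_toReal_a22Const_coordPow i).mono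
    (Set.Icc_subset_Ioo hs₀ hs₁1)
  obtain ⟨s, hs, hst⟩ := intermediate_value_Icc (show s₀ ≤ s₁ by linarith) hcont ⟨ht, hbig⟩
  exact ⟨s, hs.1, hs.2.trans_lt hs₁1, hst⟩

/-- Otherwise the left side of the bound is infinite and the right side finite. -/
lemma mul_one_add_lt_one_of_revHolder (i : Fin n) {s r : ℝ} {C : ℝ≥0} (hs : 0 ≤ s) (hs1 : s < 1)
    (hr : 0 < r) (h : RevHolder C (coordPow i s) (fun _ => 1) r) : s * (1 + r) < 1 := by
  by_contra! hge
  have hpow : (fun x : Fin n → ℝ => coordPow i s x ^ (1 + r)) = coordPow i (s * (1 + r)) := by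
    funext x
    rw [coordPow, coordPow, Real.rpow_mul (abs_nonneg _)]
  have hfin := (isA22_coordPow i hs hs1).const_lt_top.ne
  rw [RevHolder, hpow] at h
  simp only [Real.one_rpow] at h
  rw [a22Const_coordPow_eq_top i hge, top_le_iff] at h
  exact ENNReal.mul_ne_top ENNReal.coe_ne_top
    (ENNReal.rpow_ne_top_of_nonneg (by linarith) hfin) h

theorem exists_forall_le_of_forall_revHolder (hn : 1 ≤ n) {t₀ : ℝ} (ht₀ : 1 < t₀) :
    ∃ K : ℝ, 0 < K ∧ ∀ (r : ℝ → ℝ) (C : ℝ≥0), (∀ t : ℝ, 1 ≤ t → 0 < r t) →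
      (∀ w₁ w₂ : (Fin n → ℝ) → ℝ, IsA22 w₁ w₂ → RevHolder C w₁ w₂ (r (a22Const w₁ w₂).toReal)) →
      ∀ t : ℝ, t₀ ≤ t → r t ≤ K * t ^ (-2 : ℤ) := by
  obtain ⟨s₀, hs₀, hs₀', hle⟩ := exists_toReal_a22Const_coordPow_le (⟨0, hn⟩ : Fin n) ht₀
  -- From `s * r < 1 - s ≤ 4 / t ^ 2` and `s₀ ≤ s`; only `s₀` brings in `t₀`.
  refine ⟨4 / s₀, by positivity, fun r C hr hC t ht => ?_⟩
  have ht0 : 0 < t := by linarith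
  obtain ⟨s, hs, hs1, hst⟩ := exists_toReal_a22Const_coordPow_eq (⟨0, hn⟩ : Fin n) hs₀ hs₀'
    (ht₀.trans_le ht) (hle.trans ht)
  have hs0 : 0 ≤ s := by linarith
  have h1s : 0 < 1 - s := by linarith
  have hA := isA22_coordPow (⟨0, hn⟩ : Fin n) hs0 hs1
  have hrt := hr t (by linarith)
  have hrev := hC _ _ hA
  rw [hst] at hrev
  have hlt := mul_one_add_lt_one_of_revHolder _ hs0 hs1 hrt hrev
  have hup : t ≤ 2 * (1 - s) ^ (-(1 / 2) : ℝ) := by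
    rw [← hst]
    exact ENNReal.toReal_le_of_le_ofReal (by positivity)
      (a22Const_coordPow_le (⟨0, hn⟩ : Fin n) hs0 hs1)
  have hsq : t ^ 2 * (1 - s) ≤ 4 := by
    rw [Real.rpow_neg h1s.le, ← Real.sqrt_eq_rpow, ← div_eq_mul_inv,
      le_div_iff₀ (Real.sqrt_pos.2 h1s)] at hup
    have := pow_le_pow_left₀ (by positivity) hup 2
    rw [mul_pow, Real.sq_sqrt h1s.le] at this
    linarith
  rw [zpow_neg, zpow_ofNat, ← div_eq_mul_inv, div_div, le_div_iff₀ (by positivity)]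
  calc r t * (s₀ * t ^ 2) ≤ r t * (s * t ^ 2) := by gcongr
    _ = s * r t * t ^ 2 := by ring
    _ ≤ (1 - s) * t ^ 2 := by gcongr; linarith
    _ ≤ 4 := by linarith

end BilinearWeights

theorem lemma08251 (n : ℕ) (hn : 1 ≤ n) :
    (∀ t₀ : ℝ, 1 < t₀ → ∃ K : ℝ, 0 < K ∧
      ∀ (r : ℝ → ℝ) (C : ℝ≥0), (∀ t : ℝ, 1 ≤ t → 0 < r t) →
        (∀ w₁ w₂ : (Fin n → ℝ) → ℝ, BilinearWeights.IsA22 w₁ w₂ →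
          BilinearWeights.RevHolder C w₁ w₂ (r (BilinearWeights.a22Const w₁ w₂).toReal)) →
        ∀ t : ℝ, t₀ ≤ t → r t ≤ K * t ^ (-2 : ℤ)) ∧
    (∃ c : ℝ, 0 < c ∧ ∃ C : ℝ≥0,
      ∀ w₁ w₂ : (Fin n → ℝ) → ℝ, BilinearWeights.IsA22 w₁ w₂ →
        ∀ r : ℝ, 0 < r → r ≤ c * (BilinearWeights.a22Const w₁ w₂).toReal ^ (-2 : ℤ) →
          BilinearWeights.RevHolder C w₁ w₂ r) := by
  refine ⟨fun t₀ ht₀ => BilinearWeights.exists_forall_le_of_forall_revHolder hn ht₀,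
    1 / (96 * 2 ^ n), by positivity, 4, fun w₁ w₂ h r hr hrT => h.revHolder hr hrT⟩
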